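/- Let $r_0:\mathbb R\to\mathbb R^3$ be a smooth closed curve of length $T>0$, parametrized by arc length and $T$-periodic, with unit tangent $\hat t=r_0'$. Let $(\hat t,\hat n_1,\hat n_2)$ be a smooth right-handed orthonormal frame along $r_0$ which is rotation-minimizing (a Bishop frame), i.e. $\hat n_1',\hat n_2'$ are parallel to $\hat t$. Let $\gamma_0\in\mathbb R$ be an angle with $\hat n_1(0)=\cos\gamma_0\,\hat n_1(T)+\sin\gamma_0\,\hat n_2(T)$, and let $\gamma:\mathbb R\to\mathbb R$ be smooth with $\gamma(s+T)-\gamma(s)=\gamma_0$ for all $s$. Use the coordinates $(x,y,s)\mapsto r_0(s)+x\hat n_1(s)+y\hat n_2(s)$, put $u=x+iy$ and $z=e^{-i\gamma(s)}u$, and let $\star$ be the Hodge star of the Euclidean metric pulled back to these coordinates, with the orientation $dx\wedge dy\wedge ds$. Let $k\in\mathbb R$. We consider one-forms $$\alpha=\alpha_s\,ds-\tfrac1{4i}\,\alpha_u\,(u\,d\bar u-\bar u\,du),\qquad \alpha_s\sim\sum_{n\ge0}\alpha_s^n,\quad \alpha_u\sim\sum_{n\ge0}\alpha_u^n,$$ where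 $\alpha_s,\alpha_u$ are real-valued formal power series in $u,\bar u$ whose coefficients are smooth functions of $s$, and $\alpha_s^n,\alpha_u^n$ are their homogeneous parts of degree $n$ in $u,\bar u$. Such an $\alpha$ is called a formal solution if $$(\star d)^2\alpha=k\,\star d\alpha$$ holds as an identity of formal power series, that is, at every degree (for $k\ne0$ this is the Beltrami equation, for $k=0$ the vacuum equation, for $B^\flat=\star d\alpha$). **(1)** For all smooth functions $A_n:\mathbb R\to\mathbb C$ ($n\ge0$) and every smooth $B_0:\mathbb R\to\mathbb R$ there is a formal solution of the form $$\alpha_s^n=A_n(s)z^n+\bar A_n(s)\bar z^n+R_n(z,\bar z,s),\qquad \alpha_u^n=\alpha_z^n(z,\bar z,s)\qquad(n\ge0),\qquad \alpha_u^0=\alpha_z^0=B_0(s),$$ where $R_n$ and $\alpha_z^n$ are real-valued homogeneous polynomials of degree $n$ in $z,\bar z$ with smooth coefficients in $s$. They are determined by the preceding terms through maps that do not depend on the choice of the $A_j$ and of $B_0$: $R_n$ is a function of $\alpha_s^j,\alpha_u^j$ with $j<n$, and, for $n\ge1$, $\alpha_z^n$ is a function of $\alpha_s^j$ with $j\le n$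 and $\alpha_u^j$ with $j<n$. If $B_0$ is $T$-periodic, then the coefficients of $R_n$ are $T$-periodic in $s$ whenever $A_j$ is $T$-periodic for all $j<n$, and those of $\alpha_z^n$ are $T$-periodic whenever $A_j$ is $T$-periodic for all $j\le n$. In particular, if $B_0$ and all $A_n$ are $T$-periodic, then the formal series $\alpha_s,\alpha_u$, written in $z,\bar z$, are $T$-periodic in $s$. If $A_0=A_1=0$, then $\alpha_s^0=\alpha_s^1=0$ and $\star d\alpha=B_0\,ds$ on the axis $u=0$. **(2)** Let $\alpha$ be any formal solution with $\star d\alpha|_{u=0}=B_0\,ds$. Then $\alpha_u^0=B_0$, and replacing $\alpha_s$ by $\alpha_s-\alpha_s^0-\alpha_s^1$ (so that $\alpha_s^0=\alpha_s^1=0$) does not change $\star d\alpha$. -/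

import Mathlib

open scoped ContDiff

noncomputable section

namespace NearAxis

/-! ### The axis and its rotation-minimizing frame

Vectors of Euclidean three-space are written as `Fin 3 → ℝ`; lengths and angles are always
expressed through the dot product. -/

/-- `r` is a smooth closed curve in Euclidean space, of length `T`, parametrized by arc length. -/
structure IsClosedArcLengthCurve (T : ℝ) (r : ℝ → Fin 3 → ℝ) : Prop where
  length_pos : 0 < T
  smooth : ContDiff ℝ ∞ r
  periodic : Function.Periodic r T
  unit_speed : ∀ s, dotProduct (deriv r s) (deriv r s) = 1

/-- `(r', n₁, n₂)` is a smooth right-handed orthonormal frame along `r` whose normal fields are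
relatively parallel: their derivatives are parallel to the tangent `r'`. -/
structure IsBishopFrame (r n₁ n₂ : ℝ → Fin 3 → ℝ) : Prop where
  smooth₁ : ContDiff ℝ ∞ n₁
  smooth₂ : ContDiff ℝ ∞ n₂
  normal : ∀ s, dotProduct (n₁ s) (deriv r s) = 0
  unit : ∀ s, dotProduct (n₁ s) (n₁ s) = 1
  right_handed : ∀ s, n₂ s = crossProduct (deriv r s) (n₁ s)
  parallel₁ : ∀ s, ∃ c : ℝ, deriv n₁ s = c • deriv r s
  parallel₂ : ∀ s, ∃ c : ℝ, deriv n₂ s = c • deriv r s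

/-- `γ₀` is (a real representative of) the angle by which the frame at the end of one period has
to be rotated, positively with respect to the tangent, to come back to the initial frame. -/
def IsFrameAngle (T : ℝ) (n₁ n₂ : ℝ → Fin 3 → ℝ) (γ₀ : ℝ) : Prop :=
  n₁ 0 = Real.cos γ₀ • n₁ T + Real.sin γ₀ • n₂ T

/-! ### Formal series in `u`, `ū` with coefficients depending on `s` -/

/-- Formal power series in the two variables `u` (index `0`) and `ū` (index `1`), whose
coefficients are complex valued functions of `s`. -/
abbrev Series : Type := MvPowerSeries (Fin 2) (ℝ → ℂ)

/-- The variable `u = x + i y`. -/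
def uSer : Series := MvPowerSeries.X 0

/-- The variable `ū = x - i y`. -/
def ubarSer : Series := MvPowerSeries.X 1

/-- A function of `s` alone, as a series. -/
def fn (f : ℝ → ℂ) : Series := MvPowerSeries.C f

/-- All coefficients are smooth functions of `s`. -/
def IsSmooth (F : Series) : Prop :=
  ∀ m, ContDiff ℝ ∞ (MvPowerSeries.coeff m F)

/-- The exponent of the monomial `u ^ i * ū ^ j`. -/
def expo (i j : ℕ) : Fin 2 →₀ ℕ := Finsupp.single 0 i + Finsupp.single 1 j

/-- The series is real valued (as a series in `x = Re u`, `y = Im u`): the coefficients of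
`u ^ i * ū ^ j` and of `u ^ j * ū ^ i` are complex conjugate. -/
def IsReal (F : Series) : Prop :=
  ∀ i j s, MvPowerSeries.coeff (expo j i) F s = star (MvPowerSeries.coeff (expo i j) F s)

/-- The homogeneous part of degree `n` in `u`, `ū`. -/
def homPart (n : ℕ) (F : Series) : Series :=
  fun m => if m.degree = n then MvPowerSeries.coeff m F else 0

/-- The sum of the homogeneous parts of degree less than `n`. -/
def below (n : ℕ) (F : Series) : Series :=
  fun m => if m.degree < n then MvPowerSeries.coeff m F else 0

/-- The derivative with respect to `s` at fixed `u`, `ū`. -/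
def derivS (F : Series) : Series :=
  fun m => deriv (MvPowerSeries.coeff m F)

/-- The partial derivatives with respect to the coordinates `(u, ū, s)`, in this order. -/
def partialD (i : Fin 3) (F : Series) : Series :=
  (![MvPowerSeries.pderiv (ℝ → ℂ) 0 F, MvPowerSeries.pderiv (ℝ → ℂ) 1 F, derivS F] :
    Fin 3 → Series) i

/-! ### The metric in rotation-minimizing coordinates and the operator `⋆d` -/

/-- The components of the map `(x, y, s) ↦ r(s) + x n₁(s) + y n₂(s)`, where
`x = (u + ū) / 2` and `y = (u - ū) / (2 i)`. -/
def embedding (r n₁ n₂ : ℝ → Fin 3 → ℝ) (a : Fin 3) : Series :=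
  fn (fun s => (r s a : ℂ))
    + fn (fun _ => 1 / 2) * (uSer + ubarSer) * fn (fun s => (n₁ s a : ℂ))
    + fn (fun _ => 1 / (2 * Complex.I)) * (uSer - ubarSer) * fn (fun s => (n₂ s a : ℂ))

/-- The Jacobian matrix of the embedding in the coordinates `(u, ū, s)`. -/
def jacobian (r n₁ n₂ : ℝ → Fin 3 → ℝ) : Matrix (Fin 3) (Fin 3) Series :=
  Matrix.of fun a i => partialD i (embedding r n₁ n₂ a)

/-- The coefficients `g i j` of the Euclidean metric pulled back by the embedding (extended
complex bilinearly), in the coordinates `(u, ū, s)`. -/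
def metric (r n₁ n₂ : ℝ → Fin 3 → ℝ) : Matrix (Fin 3) (Fin 3) Series :=
  (jacobian r n₁ n₂).transpose * jacobian r n₁ n₂

/-- The density `ρ` of the Euclidean volume form pulled back by the embedding:
`Ω = ρ du ∧ dū ∧ ds`. -/
def density (r n₁ n₂ : ℝ → Fin 3 → ℝ) : Series :=
  (jacobian r n₁ n₂).det

/-- One-forms `a 0 du + a 1 dū + a 2 ds`. -/
abbrev OneForm : Type := Fin 3 → Series

/-- The components `β i` of `da = 1/2 ε i j k β i dxʲ ∧ dxᵏ`. -/
def extD (a : OneForm) : Fin 3 → Series :=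
  ![partialD 1 (a 2) - partialD 2 (a 1),
    partialD 2 (a 0) - partialD 0 (a 2),
    partialD 0 (a 1) - partialD 1 (a 0)]

/-- The operator `⋆d` on one-forms; here
`⋆ (1/2 ε i j k β i dxʲ ∧ dxᵏ) = ρ⁻¹ g i j β j dxⁱ`. The density is invertible as a
formal series, because the embedding is nondegenerate on the axis. -/
def starD (r n₁ n₂ : ℝ → Fin 3 → ℝ) (a : OneForm) : OneForm :=
  fun i => Ring.inverse (density r n₁ n₂) * ∑ j, metric r n₁ n₂ i j * extD a j

/-- The gauge-fixed vector potential
`α = α_s ds - (1 / (4 i)) α_u (u dū - ū du)`. -/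
def gaugeForm (αs αu : Series) : OneForm :=
  ![fn (fun _ => 1 / (4 * Complex.I)) * αu * ubarSer,
    -(fn (fun _ => 1 / (4 * Complex.I)) * αu * uSer),
    αs]

/-- The Beltrami equation `(⋆d)² α = k ⋆d α` (the vacuum equation if `k = 0`). -/
def IsBeltramiPotential (r n₁ n₂ : ℝ → Fin 3 → ℝ) (k : ℝ) (a : OneForm) : Prop :=
  ∀ i, starD r n₁ n₂ (starD r n₁ n₂ a) i = fn (fun _ => (k : ℂ)) * starD r n₁ n₂ a i

/-- The covariant field `B♭ = ⋆dα` restricts to `B₀ ds` on the axis `u = 0`. -/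
def OnAxisField (r n₁ n₂ : ℝ → Fin 3 → ℝ) (a : OneForm) (B₀ : ℝ → ℝ) : Prop :=
  MvPowerSeries.constantCoeff (starD r n₁ n₂ a 0) = 0 ∧
  MvPowerSeries.constantCoeff (starD r n₁ n₂ a 1) = 0 ∧
  MvPowerSeries.constantCoeff (starD r n₁ n₂ a 2) = fun s => (B₀ s : ℂ)

/-! ### Polynomials in `z = e^{-iγ} u` -/

/-- `z = e^{-iγ} u`. -/
def zSer (γ : ℝ → ℝ) : Series :=
  fn (fun s => Complex.exp (-(Complex.I * (γ s : ℂ)))) * uSer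

/-- `z̄ = e^{iγ} ū`. -/
def zbarSer (γ : ℝ → ℝ) : Series :=
  fn (fun s => Complex.exp (Complex.I * (γ s : ℂ))) * ubarSer

/-- Families of coefficients, indexed by the exponents `(i, j)` of `z ^ i * z̄ ^ j`. -/
abbrev Coeffs : Type := ℕ × ℕ → ℝ → ℂ

/-- The homogeneous polynomial of degree `n` in `z`, `z̄` with coefficients `c`. -/
def zPoly (γ : ℝ → ℝ) (n : ℕ) (c : Coeffs) : Series :=
  ∑ p ∈ Finset.HasAntidiagonal.antidiagonal n, fn (c p) * zSer γ ^ p.1 * zbarSer γ ^ p.2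

/-- The coefficients are smooth, and those of `z ^ i * z̄ ^ j` and `z ^ j * z̄ ^ i` are complex
conjugate, so that the polynomial is real valued. -/
def IsRealCoeffs (c : Coeffs) : Prop :=
  (∀ p, ContDiff ℝ ∞ (c p)) ∧ ∀ i j s, c (j, i) s = star (c (i, j) s)

/-- All coefficients are `T`-periodic in `s`. -/
def IsPeriodicCoeffs (T : ℝ) (c : Coeffs) : Prop :=
  ∀ p, Function.Periodic (c p) T

/-- The series, rewritten in the variables `z`, `z̄`, has `T`-periodic coefficients. -/
def IsPeriodicInZ (γ : ℝ → ℝ) (T : ℝ) (F : Series) : Prop :=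
  ∃ c : Coeffs, IsPeriodicCoeffs T c ∧ ∀ n, homPart n F = zPoly γ n c

end NearAxis

end

open NearAxis

/-!
In the coordinates `(u, ū, s)` the Bishop frame makes the metric `h² ds² + du dū` with
`h = 1 + η u + η̄ ū`, where `η` is the complex curvature of the axis (`metric_eq`, `density_eq`).
Hence `⋆d` only involves `h` and `h⁻¹` (`starD_eq`). Write `b = ⋆dα` and `G = db - k dα`; the
equation `(⋆d)² α = k ⋆dα` holds once `G = 0`. Let `E = u ∂_u + ū ∂_ū` be the Euler operator.

Since `h - 1` has no constant term, the `du ∧ dū` component of `G = 0` (the axial one) has the form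
`∂_u ∂_ū α_s = axialSource`, and the contraction of the two other components with the radial field
(the angular component) has the form `E (E + 2) α_u / 2 = angularSource`. In these, the source of
degree `n - 2`, respectively `n`, only involves lower orders (and `α_s` of degree `n` in the second
case). The kernel of `∂_u ∂_ū` on real series consists of the terms `A_n z ^ n + Ā_n z̄ ^ n`, and
the kernel of `E (E + 2)` of the functions `B₀` of `s`. With the explicit right inverses `invMixed`
and `invEuler` the two equations become a fixed point problem for causal operators, which is solved
order by order (`exists_fixedPoint`). The rest of `G = 0` is automatic: `G` is closed, and a closed
two-form without axial and angular component satisfies `(E + 1) G = 0`, so it vanishes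
(`eq_zero_of_divergence_free`).

The solution is real because all operators commute with complex conjugation (`conj`). Periodicity
rests on the holonomy of the frame: `n₁ - i n₂`, and with it `η`, is multiplied by `e^{-iγ₀}` under
`s ↦ s + T` (`frame_holonomy`, `curvature_add_period`). Hence every operator respects the
transformation law `IsTwisted`, which for weight `0` is `T`-periodicity in the variables `z`, `z̄`.

For the second part, the field on the axis is `α_u⁰ ds` plus a multiple of the first order part of
`α_s` (`onAxisField_iff`), so that part vanishes, and `α_s⁰ ds` is closed because `α_s⁰` is a
function of `s` alone.
-/

noncomputable section

namespace NearAxis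

open MvPowerSeries

/-! ### Coefficients of formal series -/

theorem expo_zero (i j : ℕ) : expo i j 0 = i := by simp [expo]

theorem expo_one (i j : ℕ) : expo i j 1 = j := by simp [expo]

theorem expo_eta (m : Fin 2 →₀ ℕ) : expo (m 0) (m 1) = m := by
  ext i
  fin_cases i
  · exact expo_zero _ _
  · exact expo_one _ _

theorem degree_eq_add (m : Fin 2 →₀ ℕ) : m.degree = m 0 + m 1 := by
  rw [Finsupp.degree_eq_sum, Fin.sum_univ_two]

theorem degree_expo (i j : ℕ) : (expo i j).degree = i + j := by
  rw [degree_eq_add, expo_zero, expo_one]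

theorem expo_add_single_zero (i j : ℕ) : expo i j + Finsupp.single 0 1 = expo (i + 1) j := by
  rw [expo, expo, Finsupp.single_add]; abel

theorem expo_add_single_one (i j : ℕ) : expo i j + Finsupp.single 1 1 = expo i (j + 1) := by
  rw [expo, expo, Finsupp.single_add]; abel

/-- The coefficient of `u ^ i * ū ^ j`. -/
abbrev cf (i j : ℕ) : Series →ₗ[ℝ → ℂ] (ℝ → ℂ) := coeff (expo i j)

theorem ext_cf {F G : Series} (h : ∀ i j, cf i j F = cf i j G) : F = G := by
  refine MvPowerSeries.ext fun m => ?_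
  rw [← expo_eta m]
  exact h _ _

/-- The series with given coefficients of `u ^ i * ū ^ j`. -/
def ofCoeffs (c : ℕ → ℕ → ℝ → ℂ) : Series := fun m => c (m 0) (m 1)

@[simp] theorem cf_ofCoeffs (c : ℕ → ℕ → ℝ → ℂ) (i j : ℕ) : cf i j (ofCoeffs c) = c i j := by
  change c (expo i j 0) (expo i j 1) = _
  rw [expo_zero, expo_one]

@[simp] theorem cf_derivS (F : Series) (i j : ℕ) : cf i j (derivS F) = deriv (cf i j F) := rfl

theorem coeff_derivS (F : Series) (m : Fin 2 →₀ ℕ) :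
    coeff m (derivS F) = deriv (coeff m F) := rfl

theorem coeff_below (n : ℕ) (F : Series) (m : Fin 2 →₀ ℕ) :
    coeff m (below n F) = if m.degree < n then coeff m F else 0 := rfl

theorem coeff_homPart (n : ℕ) (F : Series) (m : Fin 2 →₀ ℕ) :
    coeff m (homPart n F) = if m.degree = n then coeff m F else 0 := rfl

theorem cf_homPart (n : ℕ) (F : Series) (i j : ℕ) :
    cf i j (homPart n F) = if i + j = n then cf i j F else 0 := by
  rw [cf, coeff_homPart, degree_expo]

@[simp] theorem cf_fn_mul (f : ℝ → ℂ) (F : Series) (i j : ℕ) :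
    cf i j (fn f * F) = f * cf i j F := coeff_C_mul _ _ _

@[simp] theorem cf_pderiv_zero (F : Series) (i j : ℕ) :
    cf i j (pderiv (ℝ → ℂ) 0 F) = cf (i + 1) j F * ((i : ℝ → ℂ) + 1) := by
  rw [cf, coeff_pderiv, expo_add_single_zero, expo_zero]

@[simp] theorem cf_pderiv_one (F : Series) (i j : ℕ) :
    cf i j (pderiv (ℝ → ℂ) 1 F) = cf i (j + 1) F * ((j : ℝ → ℂ) + 1) := by
  rw [cf, coeff_pderiv, expo_add_single_one, expo_one]

@[simp] theorem cf_succ_uSer_mul (F : Series) (i j : ℕ) :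
    cf (i + 1) j (uSer * F) = cf i j F := by
  rw [cf, ← expo_add_single_zero, add_comm, uSer, X_def, coeff_add_monomial_mul, one_mul]

@[simp] theorem cf_zero_uSer_mul (F : Series) (j : ℕ) : cf 0 j (uSer * F) = 0 := by
  rw [cf, uSer, X_def, coeff_monomial_mul, if_neg]
  intro h
  have := h 0
  simp [expo] at this

@[simp] theorem cf_succ_ubarSer_mul (F : Series) (i j : ℕ) :
    cf i (j + 1) (ubarSer * F) = cf i j F := by
  rw [cf, ← expo_add_single_one, add_comm, ubarSer, X_def, coeff_add_monomial_mul, one_mul]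

@[simp] theorem cf_zero_ubarSer_mul (F : Series) (i : ℕ) : cf i 0 (ubarSer * F) = 0 := by
  rw [cf, ubarSer, X_def, coeff_monomial_mul, if_neg]
  intro h
  have := h 1
  simp [expo] at this

theorem cf_fn (f : ℝ → ℂ) (i j : ℕ) : cf i j (fn f) = if i = 0 ∧ j = 0 then f else 0 := by
  classical
  rw [cf, fn, coeff_C]
  congr 1
  rw [eq_iff_iff]
  constructor
  · intro h
    rw [← expo_zero i j, h, ← expo_one i j, h]
    exact ⟨rfl, by simp⟩
  · rintro ⟨rfl, rfl⟩
    simp [expo]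

theorem cf_zero_zero (F : Series) : cf 0 0 F = constantCoeff F := by
  simp [cf, expo]

theorem fn_mul (f g : ℝ → ℂ) : fn (f * g) = fn f * fn g := map_mul C f g
theorem fn_add (f g : ℝ → ℂ) : fn (f + g) = fn f + fn g := map_add C f g
theorem fn_neg (f : ℝ → ℂ) : fn (-f) = -fn f := map_neg C f
theorem fn_zero : fn 0 = 0 := map_zero C
theorem fn_one : fn 1 = 1 := map_one C

/-! ### Derivatives of formal series -/

@[simp] theorem pderiv_fn_mul (i : Fin 2) (f : ℝ → ℂ) (F : Series) :
    pderiv (ℝ → ℂ) i (fn f * F) = fn f * pderiv (ℝ → ℂ) i F := by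
  rw [Derivation.leibniz, fn, pderiv_C]; simp

@[simp] theorem pderiv_fn (i : Fin 2) (f : ℝ → ℂ) : pderiv (ℝ → ℂ) i (fn f) = 0 := pderiv_C

theorem pderiv_mul (i : Fin 2) (F G : Series) :
    pderiv (ℝ → ℂ) i (F * G) = F * pderiv (ℝ → ℂ) i G + G * pderiv (ℝ → ℂ) i F := by
  rw [Derivation.leibniz, smul_eq_mul, smul_eq_mul]

@[simp] theorem pderiv_zero_uSer : pderiv (ℝ → ℂ) 0 uSer = 1 := pderiv_X_self
@[simp] theorem pderiv_one_ubarSer : pderiv (ℝ → ℂ) 1 ubarSer = 1 := pderiv_X_self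
@[simp] theorem pderiv_one_uSer : pderiv (ℝ → ℂ) 1 uSer = 0 := pderiv_X_of_ne (by decide)
@[simp] theorem pderiv_zero_ubarSer : pderiv (ℝ → ℂ) 0 ubarSer = 0 := pderiv_X_of_ne (by decide)

theorem pderiv_comm (F : Series) :
    pderiv (ℝ → ℂ) 0 (pderiv (ℝ → ℂ) 1 F) = pderiv (ℝ → ℂ) 1 (pderiv (ℝ → ℂ) 0 F) := by
  refine ext_cf fun i j => ?_
  simp only [cf_pderiv_zero, cf_pderiv_one]
  ring

theorem deriv_mul_natCast_add_one (f : ℝ → ℂ) (i : ℕ) :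
    deriv (f * ((i : ℝ → ℂ) + 1)) = deriv f * ((i : ℝ → ℂ) + 1) := by
  funext s
  exact deriv_mul_const_field (u := f) ((i : ℂ) + 1)

/-- No differentiability is needed: `∂_u` and `∂_ū` move the coefficients and multiply them by
constants. -/
theorem derivS_pderiv (i : Fin 2) (F : Series) :
    derivS (pderiv (ℝ → ℂ) i F) = pderiv (ℝ → ℂ) i (derivS F) := by
  refine ext_cf fun a b => ?_
  fin_cases i
  · simp [deriv_mul_natCast_add_one]
  · simp [deriv_mul_natCast_add_one]

theorem derivS_uSer_mul (F : Series) : derivS (uSer * F) = uSer * derivS F := by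
  refine ext_cf fun i j => ?_
  cases i <;> simp

theorem derivS_ubarSer_mul (F : Series) : derivS (ubarSer * F) = ubarSer * derivS F := by
  refine ext_cf fun i j => ?_
  cases j <;> simp

theorem derivS_const_mul (c : ℂ) (F : Series) :
    derivS (fn (fun _ => c) * F) = fn (fun _ => c) * derivS F := by
  refine ext_cf fun i j => ?_
  simp only [cf_derivS, cf_fn_mul]
  funext s
  exact deriv_const_mul_field (v := cf i j F) c

theorem derivS_fn (f : ℝ → ℂ) : derivS (fn f) = fn (deriv f) := by
  refine ext_cf fun i j => ?_
  rw [cf_derivS, cf_fn, cf_fn]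
  split_ifs
  · rfl
  · exact deriv_const' 0

/-- The Euler operator `u ∂_u + ū ∂_ū`, which multiplies the homogeneous part of degree `n`
by `n`. -/
def euler (F : Series) : Series := uSer * pderiv (ℝ → ℂ) 0 F + ubarSer * pderiv (ℝ → ℂ) 1 F

theorem cf_euler (F : Series) (i j : ℕ) :
    cf i j (euler F) = ((i : ℝ → ℂ) + j) * cf i j F := by
  rw [euler]
  rcases i with _ | i <;> rcases j with _ | j <;> simp <;> ring

/-! ### Smooth coefficients -/

theorem IsSmooth.add {F G : Series} (hF : IsSmooth F) (hG : IsSmooth G) : IsSmooth (F + G) :=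
  fun m => by rw [map_add]; exact (hF m).add (hG m)

theorem IsSmooth.neg {F : Series} (hF : IsSmooth F) : IsSmooth (-F) :=
  fun m => by rw [map_neg]; exact (hF m).neg

theorem IsSmooth.sub {F G : Series} (hF : IsSmooth F) (hG : IsSmooth G) : IsSmooth (F - G) :=
  fun m => by rw [map_sub]; exact (hF m).sub (hG m)

theorem IsSmooth.mul {F G : Series} (hF : IsSmooth F) (hG : IsSmooth G) : IsSmooth (F * G) := by
  classical
  intro m
  rw [coeff_mul]
  have : (∑ p ∈ Finset.HasAntidiagonal.antidiagonal m, coeff p.1 F * coeff p.2 G)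
      = fun s => ∑ p ∈ Finset.HasAntidiagonal.antidiagonal m, coeff p.1 F s * coeff p.2 G s := by
    funext s; simp
  rw [this]
  exact ContDiff.sum fun p _ => (hF p.1).mul (hG p.2)

theorem isSmooth_iff {F : Series} : IsSmooth F ↔ ∀ i j, ContDiff ℝ ∞ (cf i j F) :=
  ⟨fun h i j => h _, fun h m => by rw [← expo_eta m]; exact h _ _⟩

theorem isSmooth_zero : IsSmooth 0 := fun _ => contDiff_const

theorem isSmooth_fn {f : ℝ → ℂ} (hf : ContDiff ℝ ∞ f) : IsSmooth (fn f) := by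
  refine isSmooth_iff.2 fun i j => ?_
  rw [cf_fn]
  split_ifs
  · exact hf
  · exact contDiff_const

theorem isSmooth_one : IsSmooth 1 := by
  rw [← fn_one]; exact isSmooth_fn contDiff_const

theorem isSmooth_X (i : Fin 2) : IsSmooth (X i) := by
  classical
  intro m
  rw [coeff_X]
  split_ifs <;> exact contDiff_const

theorem isSmooth_uSer : IsSmooth uSer := isSmooth_X 0

theorem isSmooth_ubarSer : IsSmooth ubarSer := isSmooth_X 1

theorem IsSmooth.pderiv {F : Series} (hF : IsSmooth F) (i : Fin 2) :
    IsSmooth (MvPowerSeries.pderiv (ℝ → ℂ) i F) := by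
  intro m
  rw [coeff_pderiv]
  exact (hF _).mul (contDiff_const (c := (m i : ℂ) + 1))

theorem IsSmooth.derivS {F : Series} (hF : IsSmooth F) : IsSmooth (derivS F) :=
  fun m => (contDiff_infty_iff_deriv.1 (hF m)).2

theorem IsSmooth.below {F : Series} (hF : IsSmooth F) (n : ℕ) : IsSmooth (below n F) := by
  intro m
  rw [coeff_below]
  split_ifs
  · exact hF m
  · exact contDiff_const

theorem IsSmooth.differentiable {F : Series} (hF : IsSmooth F) (m : Fin 2 →₀ ℕ) :
    Differentiable ℝ (coeff m F) := (hF m).differentiable (by simp)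

/-- Smoothness matters here, since `deriv` vanishes where a coefficient is not differentiable. -/
theorem derivS_add {F G : Series} (hF : IsSmooth F) (hG : IsSmooth G) :
    derivS (F + G) = derivS F + derivS G := by
  refine MvPowerSeries.ext fun m => ?_
  funext s
  rw [coeff_derivS, map_add, map_add]
  exact deriv_add (hF.differentiable m s) (hG.differentiable m s)

theorem derivS_sub {F G : Series} (hF : IsSmooth F) (hG : IsSmooth G) :
    derivS (F - G) = derivS F - derivS G := by
  refine MvPowerSeries.ext fun m => ?_
  funext s
  rw [coeff_derivS, map_sub, map_sub]
  exact deriv_sub (hF.differentiable m s) (hG.differentiable m s)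

/-! ### Complex conjugation of formal series -/

/-- The complex conjugate of a series: the coefficients are conjugated and `u`, `ū` exchanged. -/
def conj : Series →+* Series :=
  (MvPowerSeries.map (starRingEnd (ℝ → ℂ))).comp
    (MvPowerSeries.rename (R := ℝ → ℂ) (Equiv.swap (0 : Fin 2) 1)).toRingHom

@[simp] theorem cf_conj (F : Series) (i j : ℕ) : cf i j (conj F) = star (cf j i F) := by
  have h : expo i j = (expo j i).embDomain (Equiv.swap (0 : Fin 2) 1).toEmbedding := by
    simp [expo, Finsupp.embDomain_add, Finsupp.embDomain_single, add_comm]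
  change coeff (expo i j) (MvPowerSeries.map (starRingEnd (ℝ → ℂ))
    (MvPowerSeries.rename (Equiv.swap (0 : Fin 2) 1) F)) = _
  rw [coeff_map, h]
  exact congrArg star (coeff_embDomain_rename (R := ℝ → ℂ)
    (Equiv.swap (0 : Fin 2) 1).toEmbedding F (expo j i))

theorem isReal_iff {F : Series} : IsReal F ↔ conj F = F := by
  constructor
  · intro h
    refine ext_cf fun i j => ?_
    rw [cf_conj]
    funext s
    exact (h j i s).symm
  · intro h i j s
    change cf j i F s = star (cf i j F s)
    conv_lhs => rw [← h, cf_conj]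
    rfl

@[simp] theorem conj_fn (f : ℝ → ℂ) : conj (fn f) = fn (star f) := by
  refine ext_cf fun i j => ?_
  rw [cf_conj, cf_fn, cf_fn]
  by_cases h : i = 0 ∧ j = 0
  · rw [if_pos h, if_pos h.symm]
  · rw [if_neg h, if_neg fun h' => h h'.symm, star_zero]

@[simp] theorem conj_uSer : conj uSer = ubarSer := by
  simp [conj, uSer, ubarSer]

@[simp] theorem conj_ubarSer : conj ubarSer = uSer := by
  simp [conj, uSer, ubarSer]

@[simp] theorem conj_pderiv_zero (F : Series) :
    conj (pderiv (ℝ → ℂ) 0 F) = pderiv (ℝ → ℂ) 1 (conj F) := by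
  refine ext_cf fun i j => ?_
  simp

@[simp] theorem conj_pderiv_one (F : Series) :
    conj (pderiv (ℝ → ℂ) 1 F) = pderiv (ℝ → ℂ) 0 (conj F) := by
  refine ext_cf fun i j => ?_
  simp

@[simp] theorem conj_derivS (F : Series) : conj (derivS F) = derivS (conj F) := by
  refine ext_cf fun i j => ?_
  rw [cf_conj, cf_derivS, cf_derivS, cf_conj]
  funext s
  exact (deriv.star (f := cf j i F) (x := s)).symm

/-! ### Behaviour under translation by one period -/

/-- The series `F` is twisted of weight `w`: translating `s` by `T` multiplies the coefficient
of `u ^ i * ū ^ j` by `ζ ^ (i - j + w)`. For `ζ = e^{-iγ₀}` and `w = 0` this says that the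
coefficients of `F` in the variables `z`, `z̄` are `T`-periodic. -/
def IsTwisted (ζ : ℂ) (T : ℝ) (w : ℤ) (F : Series) : Prop :=
  ∀ m s, coeff m F (s + T) = ζ ^ ((m 0 : ℤ) - m 1 + w) * coeff m F s

section Twisted

variable {ζ : ℂ} {T : ℝ} {w v : ℤ} {F G : Series}

theorem IsTwisted.add (hF : IsTwisted ζ T w F) (hG : IsTwisted ζ T w G) :
    IsTwisted ζ T w (F + G) := by
  intro m s
  simp only [map_add, Pi.add_apply, hF m s, hG m s]
  ring

theorem IsTwisted.neg (hF : IsTwisted ζ T w F) : IsTwisted ζ T w (-F) := by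
  intro m s
  simp only [map_neg, Pi.neg_apply, hF m s]
  ring

theorem IsTwisted.sub (hF : IsTwisted ζ T w F) (hG : IsTwisted ζ T w G) :
    IsTwisted ζ T w (F - G) := by
  rw [sub_eq_add_neg]; exact hF.add hG.neg

theorem IsTwisted.mul (hζ : ζ ≠ 0) (hF : IsTwisted ζ T w F) (hG : IsTwisted ζ T v G) :
    IsTwisted ζ T (w + v) (F * G) := by
  classical
  intro m s
  simp only [coeff_mul, Finset.sum_apply, Pi.mul_apply, Finset.mul_sum]
  refine Finset.sum_congr rfl fun p hp => ?_
  rw [Finset.HasAntidiagonal.mem_antidiagonal] at hp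
  rw [hF, hG, ← hp]
  have : (((p.1 + p.2) 0 : ℕ) : ℤ) - ((p.1 + p.2) 1 : ℕ) + (w + v)
      = ((p.1 0 : ℤ) - p.1 1 + w) + ((p.2 0 : ℤ) - p.2 1 + v) := by
    simp only [Finsupp.add_apply]; push_cast; ring
  rw [this, zpow_add₀ hζ (_ + w)]
  exact mul_mul_mul_comm (_ : ℂ) _ _ _

theorem isTwisted_iff : IsTwisted ζ T w F ↔
    ∀ (i j : ℕ) s, cf i j F (s + T) = ζ ^ ((i : ℤ) - j + w) * cf i j F s := by
  constructor
  · intro h i j s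
    have := h (expo i j) s
    rwa [expo_zero, expo_one] at this
  · intro h m s
    have := h (m 0) (m 1) s
    rwa [cf, expo_eta] at this

theorem isTwisted_zero : IsTwisted ζ T w 0 := by
  intro m s; simp

theorem isTwisted_fn {f : ℝ → ℂ} (hf : ∀ s, f (s + T) = ζ ^ w * f s) :
    IsTwisted ζ T w (fn f) := by
  refine isTwisted_iff.2 fun i j s => ?_
  rw [cf_fn]
  split_ifs with h
  · rw [h.1, h.2, hf]; simp
  · simp

theorem isTwisted_const (c : ℂ) : IsTwisted ζ T 0 (fn fun _ => c) :=
  isTwisted_fn fun s => by simp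

theorem isTwisted_one : IsTwisted ζ T 0 1 := by
  rw [← fn_one]; exact isTwisted_const 1

theorem isTwisted_uSer : IsTwisted ζ T (-1) uSer := by
  classical
  intro m s
  rw [uSer, coeff_X]
  split_ifs with h
  · simp [h]
  · simp

theorem isTwisted_ubarSer : IsTwisted ζ T 1 ubarSer := by
  classical
  intro m s
  rw [ubarSer, coeff_X]
  split_ifs with h
  · simp [h]
  · simp

theorem IsTwisted.pderiv_zero (hF : IsTwisted ζ T w F) :
    IsTwisted ζ T (w + 1) (pderiv (ℝ → ℂ) 0 F) := by
  rw [isTwisted_iff] at hF ⊢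
  intro i j s
  have := hF (i + 1) j s
  simp only [cf_pderiv_zero, Pi.mul_apply, this, Pi.add_apply, Pi.natCast_apply, Pi.one_apply]
  push_cast
  rw [show (i : ℤ) + 1 - j + w = i - j + (w + 1) by ring]
  ring

theorem IsTwisted.pderiv_one (hF : IsTwisted ζ T w F) :
    IsTwisted ζ T (w - 1) (pderiv (ℝ → ℂ) 1 F) := by
  rw [isTwisted_iff] at hF ⊢
  intro i j s
  have := hF i (j + 1) s
  simp only [cf_pderiv_one, Pi.mul_apply, this, Pi.add_apply, Pi.natCast_apply, Pi.one_apply]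
  push_cast
  rw [show (i : ℤ) - (j + 1) + w = i - j + (w - 1) by ring]
  ring

theorem IsTwisted.derivS (hF : IsTwisted ζ T w F) : IsTwisted ζ T w (derivS F) := by
  intro m s
  rw [coeff_derivS, ← deriv_comp_add_const, funext (hF m)]
  exact deriv_const_mul_field (v := coeff m F) _

theorem IsTwisted.below (hF : IsTwisted ζ T w F) (n : ℕ) : IsTwisted ζ T w (below n F) := by
  intro m s
  rw [coeff_below]
  split_ifs
  · exact hF m s
  · simp

end Twisted

/-! ### Agreement of formal series up to a given degree -/

/-- `F` and `G` have the same coefficients in all degrees less than `n`. -/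
def AgreeBelow (n : ℕ) (F G : Series) : Prop :=
  ∀ m : Fin 2 →₀ ℕ, m.degree < n → coeff m F = coeff m G

section AgreeBelow

variable {n k : ℕ} {F G F' G' : Series}

theorem AgreeBelow.refl (n : ℕ) (F : Series) : AgreeBelow n F F := fun _ _ => rfl

theorem AgreeBelow.symm (h : AgreeBelow n F G) : AgreeBelow n G F := fun m hm => (h m hm).symm

theorem AgreeBelow.trans (h : AgreeBelow n F G) (h' : AgreeBelow n G F') : AgreeBelow n F F' :=
  fun m hm => (h m hm).trans (h' m hm)

theorem AgreeBelow.mono (h : AgreeBelow n F G) (hk : k ≤ n) : AgreeBelow k F G :=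
  fun m hm => h m (hm.trans_le hk)

theorem eq_of_agreeBelow (h : ∀ n, AgreeBelow n F G) : F = G :=
  MvPowerSeries.ext fun m => h (m.degree + 1) m (Nat.lt_succ_self _)

theorem agreeBelow_below (n : ℕ) (F : Series) : AgreeBelow n F (below n F) := by
  intro m hm
  rw [coeff_below, if_pos hm]

theorem AgreeBelow.below_eq (h : AgreeBelow n F G) : below n F = below n G := by
  refine MvPowerSeries.ext fun m => ?_
  rw [coeff_below, coeff_below]
  split_ifs with hm
  · exact h m hm
  · rfl

theorem AgreeBelow.homPart_eq (h : AgreeBelow (n + 1) F G) : homPart n F = homPart n G := by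
  refine MvPowerSeries.ext fun m => ?_
  rw [coeff_homPart, coeff_homPart]
  split_ifs with hm
  · exact h m (by omega)
  · rfl

theorem agreeBelow_iff :
    AgreeBelow n F G ↔ ∀ i j, i + j < n → cf i j F = cf i j G := by
  constructor
  · intro h i j hij
    exact h _ (by rwa [degree_expo])
  · intro h m hm
    rw [← expo_eta m]
    exact h _ _ (by rwa [← degree_eq_add])

theorem AgreeBelow.add (h : AgreeBelow n F G) (h' : AgreeBelow n F' G') :
    AgreeBelow n (F + F') (G + G') := by
  intro m hm; rw [map_add, map_add, h m hm, h' m hm]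

theorem AgreeBelow.neg (h : AgreeBelow n F G) : AgreeBelow n (-F) (-G) := by
  intro m hm; rw [map_neg, map_neg, h m hm]

theorem AgreeBelow.sub (h : AgreeBelow n F G) (h' : AgreeBelow n F' G') :
    AgreeBelow n (F - F') (G - G') := by
  intro m hm; rw [map_sub, map_sub, h m hm, h' m hm]

theorem AgreeBelow.mul_left (H : Series) (h : AgreeBelow n F G) :
    AgreeBelow n (H * F) (H * G) := by
  classical
  intro m hm
  rw [coeff_mul, coeff_mul]
  refine Finset.sum_congr rfl fun p hp => ?_
  rw [Finset.HasAntidiagonal.mem_antidiagonal] at hp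
  rw [h p.2 ?_]
  rw [← hp, map_add] at hm
  omega

theorem AgreeBelow.uSer_mul (h : AgreeBelow n F G) : AgreeBelow (n + 1) (uSer * F) (uSer * G) := by
  rw [agreeBelow_iff] at h ⊢
  rintro (_ | i) j hij
  · simp
  · simpa using h i j (by omega)

theorem AgreeBelow.ubarSer_mul (h : AgreeBelow n F G) :
    AgreeBelow (n + 1) (ubarSer * F) (ubarSer * G) := by
  rw [agreeBelow_iff] at h ⊢
  rintro i (_ | j) hij
  · simp
  · simpa using h i j (by omega)

theorem AgreeBelow.pderiv (h : AgreeBelow n F G) (i : Fin 2) :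
    AgreeBelow (n - 1) (MvPowerSeries.pderiv (ℝ → ℂ) i F) (MvPowerSeries.pderiv (ℝ → ℂ) i G) := by
  intro m hm
  rw [coeff_pderiv, coeff_pderiv, h]
  rw [map_add, Finsupp.degree_single]
  omega

theorem AgreeBelow.derivS (h : AgreeBelow n F G) : AgreeBelow n (derivS F) (derivS G) := by
  intro m hm; rw [coeff_derivS, coeff_derivS, h m hm]

end AgreeBelow

/-! ### The metric in rotation-minimizing coordinates -/

/-- The complex curvature `η = (n₁' - i n₂') · r' / 2` of the axis in the frame `(n₁, n₂)`. -/
def curvature (r n₁ n₂ : ℝ → Fin 3 → ℝ) (s : ℝ) : ℂ :=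
  ((dotProduct (deriv n₁ s) (deriv r s) : ℝ)
    - Complex.I * (dotProduct (deriv n₂ s) (deriv r s) : ℝ)) / 2

/-- The deviation `η u + η̄ ū` from `1` of the scale factor along the axis. -/
def scaleDefect (r n₁ n₂ : ℝ → Fin 3 → ℝ) : Series :=
  fn (curvature r n₁ n₂) * uSer + fn (star (curvature r n₁ n₂)) * ubarSer

/-- The scale factor `h = 1 + η u + η̄ ū` along the axis: the embedding has `s`-derivative
`h r'`. -/
def scale (r n₁ n₂ : ℝ → Fin 3 → ℝ) : Series := 1 + scaleDefect r n₁ n₂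

/-- The inverse of the scale factor. -/
def scaleInv (r n₁ n₂ : ℝ → Fin 3 → ℝ) : Series := invOfUnit (scale r n₁ n₂) 1

theorem constantCoeff_scaleDefect (r n₁ n₂ : ℝ → Fin 3 → ℝ) :
    constantCoeff (scaleDefect r n₁ n₂) = 0 := by
  simp [scaleDefect, uSer, ubarSer]

theorem scale_mul_scaleInv (r n₁ n₂ : ℝ → Fin 3 → ℝ) :
    scale r n₁ n₂ * scaleInv r n₁ n₂ = 1 :=
  mul_invOfUnit _ _ (by simp [scale, constantCoeff_scaleDefect])

theorem scaleInv_eq (r n₁ n₂ : ℝ → Fin 3 → ℝ) :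
    scaleInv r n₁ n₂ = 1 - scaleDefect r n₁ n₂ * scaleInv r n₁ n₂ := by
  have := scale_mul_scaleInv r n₁ n₂
  rw [scale] at this
  linear_combination this

theorem constantCoeff_scaleInv (r n₁ n₂ : ℝ → Fin 3 → ℝ) :
    constantCoeff (scaleInv r n₁ n₂) = 1 := by
  rw [scaleInv_eq, map_sub, map_mul, constantCoeff_scaleDefect]; simp

theorem conj_scaleDefect (r n₁ n₂ : ℝ → Fin 3 → ℝ) :
    conj (scaleDefect r n₁ n₂) = scaleDefect r n₁ n₂ := by
  simp [scaleDefect, add_comm]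

theorem conj_scaleInv (r n₁ n₂ : ℝ → Fin 3 → ℝ) :
    conj (scaleInv r n₁ n₂) = scaleInv r n₁ n₂ := by
  have h := scale_mul_scaleInv r n₁ n₂
  have h' := congrArg conj h
  rw [map_mul, map_one, show conj (scale r n₁ n₂) = scale r n₁ n₂ by
    rw [scale, map_add, map_one, conj_scaleDefect]] at h'
  linear_combination (-conj (scaleInv r n₁ n₂)) * h + scaleInv r n₁ n₂ * h'

theorem hasDerivAt_ofReal_apply {v : ℝ → Fin 3 → ℝ} (hv : ContDiff ℝ ∞ v) (a : Fin 3) (s : ℝ) :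
    HasDerivAt (fun s => (v s a : ℂ)) (deriv v s a : ℂ) s :=
  (hasDerivAt_pi.1 (hv.differentiable (by simp) s).hasDerivAt a).ofReal_comp

section Frame

variable {T : ℝ} {r n₁ n₂ : ℝ → Fin 3 → ℝ}

theorem eq_dotProduct_smul {v t : Fin 3 → ℝ} (ht : dotProduct t t = 1)
    (h : ∃ c : ℝ, v = c • t) : v = dotProduct v t • t := by
  obtain ⟨c, rfl⟩ := h
  rw [smul_dotProduct, ht, smul_eq_mul, mul_one]

theorem IsBishopFrame.deriv₁ (hr : IsClosedArcLengthCurve T r) (hn : IsBishopFrame r n₁ n₂)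
    (s : ℝ) : deriv n₁ s = dotProduct (deriv n₁ s) (deriv r s) • deriv r s :=
  eq_dotProduct_smul (hr.unit_speed s) (hn.parallel₁ s)

theorem IsBishopFrame.deriv₂ (hr : IsClosedArcLengthCurve T r) (hn : IsBishopFrame r n₁ n₂)
    (s : ℝ) : deriv n₂ s = dotProduct (deriv n₂ s) (deriv r s) • deriv r s :=
  eq_dotProduct_smul (hr.unit_speed s) (hn.parallel₂ s)

/-- The null vector `(n₁ - i n₂) / 2` of the complexified normal plane. -/
def nullNormal (n₁ n₂ : ℝ → Fin 3 → ℝ) (a : Fin 3) (s : ℝ) : ℂ :=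
  (n₁ s a - Complex.I * n₂ s a) / 2

theorem embedding_eq (r n₁ n₂ : ℝ → Fin 3 → ℝ) (a : Fin 3) :
    embedding r n₁ n₂ a = fn (fun s => (r s a : ℂ)) + uSer * fn (nullNormal n₁ n₂ a)
      + ubarSer * fn (star (nullNormal n₁ n₂ a)) := by
  have h₀ : nullNormal n₁ n₂ a = (fun _ => 1 / 2) * (fun s => (n₁ s a : ℂ))
      + (fun _ => 1 / (2 * Complex.I)) * (fun s => (n₂ s a : ℂ)) := by
    funext s
    simp only [nullNormal, Pi.add_apply, Pi.mul_apply, one_div, mul_inv, Complex.inv_I]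
    ring
  have h₁ : star (nullNormal n₁ n₂ a) = (fun _ => 1 / 2) * (fun s => (n₁ s a : ℂ))
      - (fun _ => 1 / (2 * Complex.I)) * (fun s => (n₂ s a : ℂ)) := by
    funext s
    simp only [nullNormal, Pi.star_apply, Pi.sub_apply, Pi.mul_apply, one_div, mul_inv,
      Complex.inv_I, Complex.star_def, map_div₀, map_sub, map_mul, Complex.conj_ofReal,
      Complex.conj_I, Complex.conj_ofNat]
    ring
  rw [embedding, h₁, h₀]
  simp only [sub_eq_add_neg, fn_add, fn_neg, fn_mul]
  ring

theorem hasDerivAt_nullNormal (hr : IsClosedArcLengthCurve T r) (hn : IsBishopFrame r n₁ n₂)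
    (a : Fin 3) (s : ℝ) :
    HasDerivAt (nullNormal n₁ n₂ a) (curvature r n₁ n₂ s * deriv r s a) s := by
  have h₁ := hasDerivAt_ofReal_apply hn.smooth₁ a s
  have h₂ := hasDerivAt_ofReal_apply hn.smooth₂ a s
  rw [hn.deriv₁ hr s] at h₁
  rw [hn.deriv₂ hr s] at h₂
  refine ((h₁.sub (h₂.const_mul Complex.I)).div_const 2).congr_deriv ?_
  simp only [curvature, Pi.smul_apply, smul_eq_mul, Complex.ofReal_mul]
  ring

theorem contDiff_ofReal_apply {v : ℝ → Fin 3 → ℝ} (hv : ContDiff ℝ ∞ v) (a : Fin 3) :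
    ContDiff ℝ ∞ fun s => (v s a : ℂ) :=
  Complex.ofRealCLM.contDiff.comp (contDiff_pi.1 hv a)

theorem contDiff_nullNormal (hn : IsBishopFrame r n₁ n₂) (a : Fin 3) :
    ContDiff ℝ ∞ (nullNormal n₁ n₂ a) :=
  ((contDiff_ofReal_apply hn.smooth₁ a).sub
    (contDiff_const.mul (contDiff_ofReal_apply hn.smooth₂ a))).div_const 2

theorem _root_.ContDiff.star_complex {f : ℝ → ℂ} (hf : ContDiff ℝ ∞ f) :
    ContDiff ℝ ∞ (star f) :=
  Complex.conjCLE.contDiff.comp hf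

theorem contDiff_curvature (hr : IsClosedArcLengthCurve T r) (hn : IsBishopFrame r n₁ n₂) :
    ContDiff ℝ ∞ (curvature r n₁ n₂) := by
  have hd : ∀ {v : ℝ → Fin 3 → ℝ}, ContDiff ℝ ∞ v → ContDiff ℝ ∞ (deriv v) :=
    fun h => (contDiff_infty_iff_deriv.1 h).2
  have hdot : ∀ {v : ℝ → Fin 3 → ℝ}, ContDiff ℝ ∞ v →
      ContDiff ℝ ∞ fun s => ((dotProduct (deriv v s) (deriv r s) : ℝ) : ℂ) := by
    intro v h
    have : ContDiff ℝ ∞ fun s => ∑ a, deriv v s a * deriv r s a := ContDiff.sum fun a _ =>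
      (contDiff_pi.1 (hd h) a).mul (contDiff_pi.1 (hd hr.smooth) a)
    exact Complex.ofRealCLM.contDiff.comp this
  exact ((hdot hn.smooth₁).sub (contDiff_const.mul (hdot hn.smooth₂))).div_const 2

theorem derivS_embedding (hr : IsClosedArcLengthCurve T r) (hn : IsBishopFrame r n₁ n₂)
    (a : Fin 3) :
    derivS (embedding r n₁ n₂ a)
      = scale r n₁ n₂ * fn (fun s => (deriv r s a : ℂ)) := by
  have hs := isSmooth_fn (contDiff_nullNormal hn a)
  have hs' := isSmooth_fn (contDiff_nullNormal hn a).star_complex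
  have hd : deriv (nullNormal n₁ n₂ a) = curvature r n₁ n₂ * fun s => (deriv r s a : ℂ) :=
    funext fun s => (hasDerivAt_nullNormal hr hn a s).deriv
  have hd' : deriv (star (nullNormal n₁ n₂ a))
      = star (curvature r n₁ n₂) * fun s => (deriv r s a : ℂ) := by
    funext s
    refine (hasDerivAt_nullNormal hr hn a s).star.deriv.trans ?_
    simp
  have hr' : deriv (fun s => (r s a : ℂ)) = fun s => (deriv r s a : ℂ) :=
    funext fun s => (hasDerivAt_ofReal_apply hr.smooth a s).deriv
  rw [embedding_eq, derivS_add ((isSmooth_fn (contDiff_ofReal_apply hr.smooth a)).add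
      (isSmooth_uSer.mul hs)) (isSmooth_ubarSer.mul hs'),
    derivS_add (isSmooth_fn (contDiff_ofReal_apply hr.smooth a)) (isSmooth_uSer.mul hs),
    derivS_uSer_mul, derivS_ubarSer_mul, derivS_fn, derivS_fn, derivS_fn, hd, hd', hr',
    fn_mul, fn_mul, scale, scaleDefect]
  ring

theorem jacobian_eq (hr : IsClosedArcLengthCurve T r) (hn : IsBishopFrame r n₁ n₂)
    (a : Fin 3) :
    jacobian r n₁ n₂ a 0 = fn (nullNormal n₁ n₂ a) ∧
    jacobian r n₁ n₂ a 1 = fn (star (nullNormal n₁ n₂ a)) ∧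
    jacobian r n₁ n₂ a 2 = scale r n₁ n₂ * fn (fun s => (deriv r s a : ℂ)) := by
  refine ⟨?_, ?_, derivS_embedding hr hn a⟩
  · change pderiv (ℝ → ℂ) 0 (embedding r n₁ n₂ a) = _
    rw [embedding_eq]
    simp
  · change pderiv (ℝ → ℂ) 1 (embedding r n₁ n₂ a) = _
    rw [embedding_eq]
    simp

/-- The inner products and the determinant of the frame, in components. -/
theorem frame_relations (hr : IsClosedArcLengthCurve T r) (hn : IsBishopFrame r n₁ n₂) (s : ℝ) :
    let t := deriv r s
    let p := n₁ s
    let q := n₂ s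
    t 0 * t 0 + t 1 * t 1 + t 2 * t 2 = 1 ∧ p 0 * p 0 + p 1 * p 1 + p 2 * p 2 = 1 ∧
    q 0 * q 0 + q 1 * q 1 + q 2 * q 2 = 1 ∧ p 0 * t 0 + p 1 * t 1 + p 2 * t 2 = 0 ∧
    q 0 * t 0 + q 1 * t 1 + q 2 * t 2 = 0 ∧ p 0 * q 0 + p 1 * q 1 + p 2 * q 2 = 0 ∧
    p 0 * (q 1 * t 2 - q 2 * t 1) - p 1 * (q 0 * t 2 - q 2 * t 0)
      + p 2 * (q 0 * t 1 - q 1 * t 0) = 1 := by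
  intro t p q
  have htt : t 0 * t 0 + t 1 * t 1 + t 2 * t 2 = 1 := by
    have := hr.unit_speed s
    rwa [dotProduct, Fin.sum_univ_three] at this
  have hpp : p 0 * p 0 + p 1 * p 1 + p 2 * p 2 = 1 := by
    have := hn.unit s
    rwa [dotProduct, Fin.sum_univ_three] at this
  have hpt : p 0 * t 0 + p 1 * t 1 + p 2 * t 2 = 0 := by
    have := hn.normal s
    rwa [dotProduct, Fin.sum_univ_three] at this
  -- the normal `n₂ = r' × n₁` in components
  have hq : q = ![t 1 * p 2 - t 2 * p 1, t 2 * p 0 - t 0 * p 2, t 0 * p 1 - t 1 * p 0] := by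
    rw [← cross_apply]; exact hn.right_handed s
  have hq0 : q 0 = t 1 * p 2 - t 2 * p 1 := congrFun hq 0
  have hq1 : q 1 = t 2 * p 0 - t 0 * p 2 := congrFun hq 1
  have hq2 : q 2 = t 0 * p 1 - t 1 * p 0 := congrFun hq 2
  rw [hq0, hq1, hq2]
  set pt := p 0 * t 0 + p 1 * t 1 + p 2 * t 2 with hpt'
  refine ⟨htt, hpp, ?_, hpt, by ring, by ring, ?_⟩
  · linear_combination (p 0 * p 0 + p 1 * p 1 + p 2 * p 2) * htt + hpp - pt * hpt
  · linear_combination (p 0 * p 0 + p 1 * p 1 + p 2 * p 2) * htt + hpp - pt * hpt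

/-- The components of the pulled back metric: `g = h² ds² + du dū`. -/
theorem metric_eq (hr : IsClosedArcLengthCurve T r) (hn : IsBishopFrame r n₁ n₂) :
    metric r n₁ n₂ = !![0, fn fun _ => 1 / 2, 0; fn fun _ => 1 / 2, 0, 0;
      0, 0, scale r n₁ n₂ * scale r n₁ n₂] := by
  have hJ := jacobian_eq hr hn
  have key : ∀ s : ℝ, ((nullNormal n₁ n₂ 0 * nullNormal n₁ n₂ 0
        + nullNormal n₁ n₂ 1 * nullNormal n₁ n₂ 1 + nullNormal n₁ n₂ 2 * nullNormal n₁ n₂ 2) s = 0)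
      ∧ ((nullNormal n₁ n₂ 0 * star (nullNormal n₁ n₂ 0)
        + nullNormal n₁ n₂ 1 * star (nullNormal n₁ n₂ 1)
        + nullNormal n₁ n₂ 2 * star (nullNormal n₁ n₂ 2)) s = 1 / 2)
      ∧ ((nullNormal n₁ n₂ 0 * (fun s => (deriv r s 0 : ℂ))
        + nullNormal n₁ n₂ 1 * (fun s => (deriv r s 1 : ℂ))
        + nullNormal n₁ n₂ 2 * (fun s => (deriv r s 2 : ℂ))) s = 0)
      ∧ (((fun s => (deriv r s 0 : ℂ)) * (fun s => (deriv r s 0 : ℂ))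
        + (fun s => (deriv r s 1 : ℂ)) * (fun s => (deriv r s 1 : ℂ))
        + (fun s => (deriv r s 2 : ℂ)) * (fun s => (deriv r s 2 : ℂ))) s = 1) := by
    intro s
    obtain ⟨htt, hpp, hqq, hpt, hqt, hpq, -⟩ := frame_relations hr hn s
    replace htt := congrArg (fun x : ℝ => (x : ℂ)) htt
    replace hpp := congrArg (fun x : ℝ => (x : ℂ)) hpp
    replace hqq := congrArg (fun x : ℝ => (x : ℂ)) hqq
    replace hpt := congrArg (fun x : ℝ => (x : ℂ)) hpt
    replace hqt := congrArg (fun x : ℝ => (x : ℂ)) hqt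
    replace hpq := congrArg (fun x : ℝ => (x : ℂ)) hpq
    push_cast at htt hpp hqq hpt hqt hpq
    have hI := Complex.I_mul_I
    simp only [Pi.add_apply, Pi.mul_apply, Pi.star_apply, nullNormal, Complex.star_def, map_div₀,
      map_sub, map_mul, Complex.conj_ofReal, Complex.conj_I, Complex.conj_ofNat]
    refine ⟨?_, ?_, ?_, htt⟩
    · linear_combination hpp / 4 - Complex.I / 2 * hpq - hqq / 4
        + (n₂ s 0 * n₂ s 0 + n₂ s 1 * n₂ s 1 + n₂ s 2 * n₂ s 2) / 4 * hI
    · linear_combination hpp / 4 + hqq / 4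
        - (n₂ s 0 * n₂ s 0 + n₂ s 1 * n₂ s 1 + n₂ s 2 * n₂ s 2) / 4 * hI
    · linear_combination hpt / 2 - Complex.I / 2 * hqt
  have h₁ := congrArg fn (funext fun s => (key s).1 : _ = (0 : ℝ → ℂ))
  have h₂ := congrArg fn (funext fun s => (key s).2.1 : _ = (fun _ => 1 / 2 : ℝ → ℂ))
  have h₃ := congrArg fn (funext fun s => (key s).2.2.1 : _ = (0 : ℝ → ℂ))
  have h₄ := congrArg fn (funext fun s => (key s).2.2.2 : _ = (1 : ℝ → ℂ))
  have h₁' := congrArg conj h₁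
  have h₃' := congrArg conj h₃
  simp only [fn_add, fn_mul, fn_zero, fn_one, map_add, map_mul, conj_fn,
    map_zero] at h₁ h₂ h₃ h₄ h₁' h₃'
  have hreal : ∀ a, star (fun s => (deriv r s a : ℂ)) = fun s => (deriv r s a : ℂ) := fun a => by
    funext s; simp
  simp only [hreal] at h₃'
  have hm : ∀ i j, metric r n₁ n₂ i j = jacobian r n₁ n₂ 0 i * jacobian r n₁ n₂ 0 j
      + jacobian r n₁ n₂ 1 i * jacobian r n₁ n₂ 1 j
      + jacobian r n₁ n₂ 2 i * jacobian r n₁ n₂ 2 j := fun i j => by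
    rw [metric, Matrix.mul_apply, Fin.sum_univ_three]; rfl
  ext1 i j
  rw [hm]
  fin_cases i <;> fin_cases j <;>
    simp [-one_div, (hJ _).1, (hJ _).2.1, (hJ _).2.2]
  · exact h₁
  · linear_combination h₂
  · linear_combination scale r n₁ n₂ * h₃
  · linear_combination h₂
  · exact h₁'
  · linear_combination scale r n₁ n₂ * h₃'
  · linear_combination scale r n₁ n₂ * h₃
  · linear_combination scale r n₁ n₂ * h₃'
  · linear_combination scale r n₁ n₂ * scale r n₁ n₂ * h₄

/-- The Euclidean volume form is `(i / 2) h du ∧ dū ∧ ds`. -/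
theorem density_eq (hr : IsClosedArcLengthCurve T r) (hn : IsBishopFrame r n₁ n₂) :
    density r n₁ n₂ = fn (fun _ => Complex.I / 2) * scale r n₁ n₂ := by
  have hJ := jacobian_eq hr hn
  set e : Fin 3 → ℝ → ℂ := nullNormal n₁ n₂ with he
  set t : Fin 3 → ℝ → ℂ := fun a s => (deriv r s a : ℂ) with ht
  have key : e 0 * star (e 1) * t 2 - e 0 * star (e 2) * t 1 - star (e 0) * e 1 * t 2
      + star (e 0) * e 2 * t 1 + t 0 * e 1 * star (e 2) - t 0 * star (e 1) * e 2
      = fun _ => Complex.I / 2 := by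
    funext s
    obtain ⟨-, -, -, -, -, -, hdet⟩ := frame_relations hr hn s
    replace hdet := congrArg (fun x : ℝ => (x : ℂ)) hdet
    push_cast at hdet
    simp only [he, ht, Pi.add_apply, Pi.sub_apply, Pi.mul_apply, Pi.star_apply, nullNormal,
      Complex.star_def, map_div₀,
      map_sub, map_mul, Complex.conj_ofReal, Complex.conj_I, Complex.conj_ofNat]
    linear_combination Complex.I / 2 * hdet
  have key' := congrArg fn key
  simp only [sub_eq_add_neg, fn_add, fn_mul, fn_neg] at key'
  rw [density, Matrix.det_fin_three]
  simp only [(hJ _).1, (hJ _).2.1, (hJ _).2.2]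
  linear_combination scale r n₁ n₂ * key'

/-- The operator `⋆d` in the coordinates `(u, ū, s)`. -/
theorem starD_eq (hr : IsClosedArcLengthCurve T r) (hn : IsBishopFrame r n₁ n₂) (a : OneForm) :
    starD r n₁ n₂ a =
      ![fn (fun _ => -Complex.I) * (scaleInv r n₁ n₂ * extD a 1),
        fn (fun _ => -Complex.I) * (scaleInv r n₁ n₂ * extD a 0),
        fn (fun _ => -(2 * Complex.I)) * (scale r n₁ n₂ * extD a 2)] := by
  have hq := scale_mul_scaleInv r n₁ n₂
  have hc : fn (fun _ => Complex.I / 2) * fn (fun _ => -(2 * Complex.I)) = 1 := by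
    rw [← fn_mul, ← fn_one]
    congr 1
    funext s
    simp only [Pi.mul_apply, Pi.one_apply]
    linear_combination -Complex.I_mul_I
  have hc' : fn (fun _ => -(2 * Complex.I)) * fn (fun _ => 1 / 2) = fn (fun _ => -Complex.I) := by
    rw [← fn_mul]
    congr 1
    funext s
    simp only [Pi.mul_apply]
    ring
  have hinv : Ring.inverse (density r n₁ n₂)
      = fn (fun _ => -(2 * Complex.I)) * scaleInv r n₁ n₂ := by
    have h1 : density r n₁ n₂ * (fn (fun _ => -(2 * Complex.I)) * scaleInv r n₁ n₂) = 1 := by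
      rw [density_eq hr hn]
      linear_combination scale r n₁ n₂ * scaleInv r n₁ n₂ * hc + hq
    exact Ring.inverse_unit (⟨density r n₁ n₂, _, h1, by rw [mul_comm]; exact h1⟩ : Seriesˣ)
  funext i
  rw [starD, hinv, Fin.sum_univ_three, metric_eq hr hn]
  fin_cases i
  · simp [-one_div]
    linear_combination (scaleInv r n₁ n₂ * extD a 1) * hc'
  · simp [-one_div]
    linear_combination (scaleInv r n₁ n₂ * extD a 0) * hc'
  · simp
    linear_combination (fn (fun _ => -(2 * Complex.I)) * scale r n₁ n₂ * extD a 2) * hq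

end Frame

/-! ### The holonomy of the frame -/

section Holonomy

variable {T γ₀ : ℝ} {r n₁ n₂ : ℝ → Fin 3 → ℝ}

theorem IsClosedArcLengthCurve.deriv_periodic (hr : IsClosedArcLengthCurve T r) (s : ℝ) :
    deriv r (s + T) = deriv r s := by
  rw [← deriv_comp_add_const]
  congr 1
  funext x
  exact hr.periodic x

/-- The rotation by `γ₀` that closes up the frame at `s = 0` does so at every `s`: the difference
of both sides is normal to the axis while its derivative is tangent, so its length is constant. -/
theorem frame_holonomy (hr : IsClosedArcLengthCurve T r) (hn : IsBishopFrame r n₁ n₂)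
    (hγ₀ : IsFrameAngle T n₁ n₂ γ₀) (s : ℝ) :
    n₁ s = Real.cos γ₀ • n₁ (s + T) + Real.sin γ₀ • n₂ (s + T) := by
  set W : ℝ → Fin 3 → ℝ :=
    fun s => n₁ s - (Real.cos γ₀ • n₁ (s + T) + Real.sin γ₀ • n₂ (s + T)) with hW
  have hd₁ : ∀ s, HasDerivAt n₁ (deriv n₁ s) s :=
    fun s => (hn.smooth₁.differentiable (by simp) s).hasDerivAt
  have hd₂ : ∀ s, HasDerivAt n₂ (deriv n₂ s) s :=
    fun s => (hn.smooth₂.differentiable (by simp) s).hasDerivAt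
  have hWd : ∀ s, ∃ c : ℝ, HasDerivAt W (c • deriv r s) s := by
    intro s
    have h := (hd₁ s).sub ((((hd₁ (s + T)).comp_add_const s T).const_smul (Real.cos γ₀)).add
      (((hd₂ (s + T)).comp_add_const s T).const_smul (Real.sin γ₀)))
    rw [hn.deriv₁ hr s, hn.deriv₁ hr (s + T), hn.deriv₂ hr (s + T), hr.deriv_periodic] at h
    refine ⟨dotProduct (deriv n₁ s) (deriv r s)
      - (Real.cos γ₀ * dotProduct (deriv n₁ (s + T)) (deriv r s)
        + Real.sin γ₀ * dotProduct (deriv n₂ (s + T)) (deriv r s)), h.congr_deriv ?_⟩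
    rw [smul_smul, smul_smul, ← add_smul, ← sub_smul]
  have hWt : ∀ s, W s 0 * deriv r s 0 + W s 1 * deriv r s 1 + W s 2 * deriv r s 2 = 0 := by
    intro s
    obtain ⟨-, -, -, h₁, -⟩ := frame_relations hr hn s
    obtain ⟨-, -, -, h₂, h₃, -⟩ := frame_relations hr hn (s + T)
    rw [hr.deriv_periodic] at h₂ h₃
    simp only [hW, Pi.sub_apply, Pi.add_apply, Pi.smul_apply, smul_eq_mul]
    linear_combination h₁ - Real.cos γ₀ * h₂ - Real.sin γ₀ * h₃
  have hconst : ∀ s, HasDerivAt (fun s => W s 0 * W s 0 + W s 1 * W s 1 + W s 2 * W s 2) 0 s := by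
    intro s
    obtain ⟨c, hc⟩ := hWd s
    have h := hasDerivAt_pi.1 hc
    refine ((((h 0).mul (h 0)).add ((h 1).mul (h 1))).add ((h 2).mul (h 2))).congr_deriv ?_
    simp only [Pi.smul_apply, smul_eq_mul]
    linear_combination 2 * c * hWt s
  have hzero : W s 0 * W s 0 + W s 1 * W s 1 + W s 2 * W s 2 = 0 := by
    have h := is_const_of_deriv_eq_zero (fun s => (hconst s).differentiableAt)
      (fun s => (hconst s).deriv) s 0
    have h0 : W 0 = 0 := by
      simp only [hW, zero_add]
      rw [sub_eq_zero]
      exact hγ₀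
    simpa [h0] using h
  have : W s = 0 := by
    funext a
    have h0 := mul_self_nonneg (W s 0)
    have h1 := mul_self_nonneg (W s 1)
    have h2 := mul_self_nonneg (W s 2)
    fin_cases a <;> exact mul_self_eq_zero.1
      (by simp only [Fin.zero_eta, Fin.mk_one, Fin.reduceFinMk]; linarith)
  exact sub_eq_zero.1 this

theorem curvature_add_period (hr : IsClosedArcLengthCurve T r) (hn : IsBishopFrame r n₁ n₂)
    (hγ₀ : IsFrameAngle T n₁ n₂ γ₀) (s : ℝ) :
    curvature r n₁ n₂ (s + T) = Complex.exp (-(Complex.I * γ₀)) * curvature r n₁ n₂ s := by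
  have h₁ := frame_holonomy hr hn hγ₀
  -- the cross product with the periodic tangent turns the relation for `n₁` into one for `n₂`
  have h₂ : ∀ s, n₂ s = Real.cos γ₀ • n₂ (s + T) - Real.sin γ₀ • n₁ (s + T) := by
    intro s
    obtain ⟨htt, -, -, hpt, -⟩ := frame_relations hr hn (s + T)
    rw [hn.right_handed s, h₁ s, hn.right_handed (s + T)]
    rw [hr.deriv_periodic] at *
    rw [cross_apply, cross_apply]
    funext a
    fin_cases a
    · simp
      linear_combination Real.sin γ₀ * (deriv r s 0 * hpt - n₁ (s + T) 0 * htt)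
    · simp
      linear_combination Real.sin γ₀ * (deriv r s 1 * hpt - n₁ (s + T) 1 * htt)
    · simp
      linear_combination Real.sin γ₀ * (deriv r s 2 * hpt - n₁ (s + T) 2 * htt)
  have hd₁ : HasDerivAt (fun s => n₁ (s + T)) (deriv n₁ (s + T)) s :=
    (hn.smooth₁.differentiable (by simp) _).hasDerivAt.comp_add_const s T
  have hd₂ : HasDerivAt (fun s => n₂ (s + T)) (deriv n₂ (s + T)) s :=
    (hn.smooth₂.differentiable (by simp) _).hasDerivAt.comp_add_const s T
  have e₁ : deriv n₁ s = Real.cos γ₀ • deriv n₁ (s + T) + Real.sin γ₀ • deriv n₂ (s + T) := by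
    conv_lhs => rw [funext h₁]
    exact ((hd₁.const_smul (Real.cos γ₀)).add (hd₂.const_smul (Real.sin γ₀))).deriv
  have e₂ : deriv n₂ s = Real.cos γ₀ • deriv n₂ (s + T) - Real.sin γ₀ • deriv n₁ (s + T) := by
    conv_lhs => rw [funext h₂]
    exact ((hd₂.const_smul (Real.cos γ₀)).sub (hd₁.const_smul (Real.sin γ₀))).deriv
  have hexp : Complex.exp (-(Complex.I * γ₀)) = Real.cos γ₀ - Real.sin γ₀ * Complex.I := by
    rw [show -(Complex.I * (γ₀ : ℂ)) = (-γ₀ : ℂ) * Complex.I by ring, Complex.exp_mul_I,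
      Complex.cos_neg, Complex.sin_neg]
    push_cast
    ring
  have hcs : ((Real.cos γ₀ : ℝ) : ℂ) ^ 2 + ((Real.sin γ₀ : ℝ) : ℂ) ^ 2 = 1 := by
    exact_mod_cast Real.cos_sq_add_sin_sq γ₀
  rw [hexp, curvature, curvature, e₁, e₂, hr.deriv_periodic]
  simp only [add_dotProduct, sub_dotProduct, smul_dotProduct, smul_eq_mul, Complex.ofReal_add,
    Complex.ofReal_sub, Complex.ofReal_mul]
  set c := ((Real.cos γ₀ : ℝ) : ℂ)
  set d := ((Real.sin γ₀ : ℝ) : ℂ)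
  set x := ((dotProduct (deriv n₁ (s + T)) (deriv r s) : ℝ) : ℂ)
  set y := ((dotProduct (deriv n₂ (s + T)) (deriv r s) : ℝ) : ℂ)
  linear_combination (-(x - Complex.I * y) / 2) * hcs
    + (d * d * x - d * c * y) / 2 * Complex.I_mul_I

end Holonomy

/-! ### Fixed points of causal operators -/

section FixedPoint

variable {S U : Series → Series → Series}

/-- A pair of operators, the first depending on strictly lower orders and the second on the same
order of the first argument and on strictly lower orders of the second, has a fixed point. -/
theorem exists_fixedPoint
    (hS : ∀ n F F' G G', AgreeBelow n F F' → AgreeBelow n G G' →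
      AgreeBelow (n + 1) (S F G) (S F' G'))
    (hU : ∀ n F F' G G', AgreeBelow (n + 1) F F' → AgreeBelow n G G' →
      AgreeBelow (n + 1) (U F G) (U F' G')) :
    ∃ F G, F = S F G ∧ G = U F G := by
  -- the iterates of the two operators stabilize in each degree
  let x : ℕ → Series × Series := fun n =>
    n.rec (0, 0) fun _ p => (S p.1 p.2, U (S p.1 p.2) p.2)
  have hx₁ : ∀ n, (x (n + 1)).1 = S (x n).1 (x n).2 := fun _ => rfl
  have hx₂ : ∀ n, (x (n + 1)).2 = U (x (n + 1)).1 (x n).2 := fun _ => rfl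
  have hstep : ∀ n, AgreeBelow n (x n).1 (x (n + 1)).1 ∧ AgreeBelow n (x n).2 (x (n + 1)).2 := by
    intro n
    induction n with
    | zero => exact ⟨fun m hm => absurd hm (Nat.not_lt_zero _),
        fun m hm => absurd hm (Nat.not_lt_zero _)⟩
    | succ n ih =>
      have h₁ : AgreeBelow (n + 1) (x (n + 1)).1 (x (n + 2)).1 := by
        rw [hx₁, hx₁ (n + 1)]; exact hS n _ _ _ _ ih.1 ih.2
      refine ⟨h₁, ?_⟩
      rw [hx₂, hx₂ (n + 1)]
      exact hU n _ _ _ _ h₁ ih.2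
  have hle : ∀ n d, AgreeBelow n (x n).1 (x (n + d)).1 ∧ AgreeBelow n (x n).2 (x (n + d)).2 := by
    intro n d
    induction d with
    | zero => exact ⟨AgreeBelow.refl _ _, AgreeBelow.refl _ _⟩
    | succ d ih => exact ⟨ih.1.trans ((hstep (n + d)).1.mono (Nat.le_add_right _ _)),
        ih.2.trans ((hstep (n + d)).2.mono (Nat.le_add_right _ _))⟩
  let F : Series := fun m => coeff m (x (m.degree + 1)).1
  let G : Series := fun m => coeff m (x (m.degree + 1)).2
  have hF : ∀ n, AgreeBelow n F (x n).1 := by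
    intro n m hm
    obtain ⟨d, rfl⟩ := Nat.exists_eq_add_of_le (Nat.succ_le_of_lt hm)
    exact (hle (m.degree + 1) d).1 m (Nat.lt_succ_self _)
  have hG : ∀ n, AgreeBelow n G (x n).2 := by
    intro n m hm
    obtain ⟨d, rfl⟩ := Nat.exists_eq_add_of_le (Nat.succ_le_of_lt hm)
    exact (hle (m.degree + 1) d).2 m (Nat.lt_succ_self _)
  refine ⟨F, G, eq_of_agreeBelow fun n => ?_, eq_of_agreeBelow fun n => ?_⟩
  · exact ((hF (n + 1)).trans (hS n _ _ _ _ (hF n) (hG n)).symm).mono (Nat.le_succ n)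
  · exact ((hG (n + 1)).trans (hU n _ _ _ _ (hF (n + 1)) (hG n)).symm).mono (Nat.le_succ n)

/-- Induction on the order for a fixed point of causal operators. -/
theorem below_induction {P : Series → Prop} {F G : Series} (N : ℕ)
    (hS : ∀ n F F' G G', AgreeBelow n F F' → AgreeBelow n G G' →
      AgreeBelow (n + 1) (S F G) (S F' G'))
    (hU : ∀ n F F' G G', AgreeBelow (n + 1) F F' → AgreeBelow n G G' →
      AgreeBelow (n + 1) (U F G) (U F' G'))
    (hF : F = S F G) (hG : G = U F G) (h0 : P 0)
    (hPS : ∀ n < N, ∀ F G, P F → P G → P (below (n + 1) (S F G)))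
    (hPU : ∀ n < N, ∀ F G, P F → P G → P (below (n + 1) (U F G))) :
    ∀ n ≤ N, P (below n F) ∧ P (below n G) := by
  have hzero : ∀ F, below 0 F = 0 := fun F => MvPowerSeries.ext fun m => by
    rw [coeff_below, if_neg (Nat.not_lt_zero _), map_zero]
  intro n
  induction n with
  | zero => intro _; rw [hzero, hzero]; exact ⟨h0, h0⟩
  | succ n ih =>
    intro hn
    obtain ⟨ih₁, ih₂⟩ := ih (by omega)
    have h₁ : P (below (n + 1) F) := by
      rw [hF, (hS n _ _ _ _ (agreeBelow_below n F) (agreeBelow_below n G)).below_eq]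
      exact hPS n (by omega) _ _ ih₁ ih₂
    refine ⟨h₁, ?_⟩
    rw [hG, (hU n _ _ _ _ (agreeBelow_below (n + 1) F) (agreeBelow_below n G)).below_eq]
    exact hPU n (by omega) _ _ h₁ ih₂

theorem isSmooth_of_below {F : Series} (h : ∀ n, IsSmooth (below n F)) : IsSmooth F := by
  intro m
  have := h (m.degree + 1) m
  rwa [coeff_below, if_pos (Nat.lt_succ_self _)] at this

theorem isTwisted_of_below {ζ : ℂ} {T : ℝ} {w : ℤ} {F : Series}
    (h : ∀ n, IsTwisted ζ T w (below n F)) : IsTwisted ζ T w F := by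
  intro m
  have := h (m.degree + 1) m
  rwa [coeff_below, if_pos (Nat.lt_succ_self _)] at this

theorem conj_below (n : ℕ) (F : Series) : conj (below n F) = below n (conj F) := by
  refine ext_cf fun i j => ?_
  rw [cf_conj, cf, cf, coeff_below, coeff_below, degree_expo, degree_expo, add_comm j i]
  split_ifs
  · exact (cf_conj F i j).symm
  · exact star_zero _

theorem conj_eq_of_below {F : Series} (h : ∀ n, conj (below n F) = below n F) : conj F = F := by
  refine eq_of_agreeBelow fun n => ?_
  have h₁ := agreeBelow_below n (conj F)
  rw [← conj_below, h] at h₁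
  exact h₁.trans (agreeBelow_below n F).symm

end FixedPoint

/-! ### The scale factor -/

section Scale

variable {T γ₀ : ℝ} {r n₁ n₂ : ℝ → Fin 3 → ℝ}

/-- Multiplication by `h - 1`, which has no constant term, raises the order. -/
theorem AgreeBelow.scaleDefect_mul {n : ℕ} {F G : Series} (r n₁ n₂ : ℝ → Fin 3 → ℝ)
    (h : AgreeBelow n F G) :
    AgreeBelow (n + 1) (scaleDefect r n₁ n₂ * F) (scaleDefect r n₁ n₂ * G) := by
  have key : ∀ F, scaleDefect r n₁ n₂ * F = uSer * (fn (curvature r n₁ n₂) * F)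
      + ubarSer * (fn (star (curvature r n₁ n₂)) * F) := fun F => by
    rw [scaleDefect]; ring
  rw [key, key]
  exact (h.mul_left _).uSer_mul.add (h.mul_left _).ubarSer_mul

/-- Induction on the order for `h⁻¹`, the fixed point of `F ↦ 1 - (h - 1) F`. -/
theorem scaleInv_induction {P : Series → Prop} (h0 : P 0)
    (hP : ∀ n F, P F → P (below n (1 - scaleDefect r n₁ n₂ * F))) (n : ℕ) :
    P (below n (scaleInv r n₁ n₂)) :=
  (below_induction (S := fun F _ => 1 - scaleDefect r n₁ n₂ * F) (U := fun _ _ => 0) (G := 0) n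
    (fun _ _ _ _ _ h _ => (AgreeBelow.refl _ _).sub (h.scaleDefect_mul r n₁ n₂))
    (fun _ _ _ _ _ _ _ => AgreeBelow.refl _ _) (scaleInv_eq r n₁ n₂) rfl h0
    (fun n _ F _ hF _ => hP (n + 1) F hF)
    (fun n _ _ _ _ _ => by
      rwa [show below (n + 1) (0 : Series) = 0 from MvPowerSeries.ext fun m => by
        rw [coeff_below]; simp]) n le_rfl).1

theorem isSmooth_scaleDefect (hr : IsClosedArcLengthCurve T r) (hn : IsBishopFrame r n₁ n₂) :
    IsSmooth (scaleDefect r n₁ n₂) :=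
  ((isSmooth_fn (contDiff_curvature hr hn)).mul isSmooth_uSer).add
    ((isSmooth_fn (contDiff_curvature hr hn).star_complex).mul isSmooth_ubarSer)

theorem isSmooth_scaleInv (hr : IsClosedArcLengthCurve T r) (hn : IsBishopFrame r n₁ n₂) :
    IsSmooth (scaleInv r n₁ n₂) :=
  isSmooth_of_below <| scaleInv_induction isSmooth_zero fun n _ hF =>
    (isSmooth_one.sub ((isSmooth_scaleDefect hr hn).mul hF)).below n

theorem IsTwisted.of_weight_eq {ζ : ℂ} {w v : ℤ} {F : Series} (hF : IsTwisted ζ T w F)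
    (h : w = v) : IsTwisted ζ T v F := h ▸ hF

theorem isTwisted_scaleDefect (hr : IsClosedArcLengthCurve T r) (hn : IsBishopFrame r n₁ n₂)
    (hγ₀ : IsFrameAngle T n₁ n₂ γ₀) :
    IsTwisted (Complex.exp (-(Complex.I * γ₀))) T 0 (scaleDefect r n₁ n₂) := by
  have hζ := Complex.exp_ne_zero (-(Complex.I * γ₀))
  have hc := curvature_add_period hr hn hγ₀
  have hstar : star (Complex.exp (-(Complex.I * γ₀)))
      = (Complex.exp (-(Complex.I * γ₀))) ^ (-1 : ℤ) := by
    rw [zpow_neg_one, ← Complex.exp_neg, Complex.star_def, ← Complex.exp_conj]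
    simp
  refine (((isTwisted_fn (w := 1) fun s => ?_).mul hζ isTwisted_uSer).of_weight_eq
    (by norm_num)).add (((isTwisted_fn (w := -1) fun s => ?_).mul hζ
      isTwisted_ubarSer).of_weight_eq (by norm_num))
  · rw [hc, zpow_one]
  · rw [Pi.star_apply, Pi.star_apply, hc, star_mul', hstar]

theorem isTwisted_scaleInv (hr : IsClosedArcLengthCurve T r) (hn : IsBishopFrame r n₁ n₂)
    (hγ₀ : IsFrameAngle T n₁ n₂ γ₀) :
    IsTwisted (Complex.exp (-(Complex.I * γ₀))) T 0 (scaleInv r n₁ n₂) :=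
  isTwisted_of_below <| scaleInv_induction isTwisted_zero fun n _ hF =>
    (isTwisted_one.sub (((isTwisted_scaleDefect hr hn hγ₀).mul (Complex.exp_ne_zero _)
      hF).of_weight_eq (add_zero 0))).below n

end Scale

/-! ### Inverting the leading operators -/

/-- A right inverse of `∂_u ∂_ū`, whose values contain no pure powers of `u` or `ū`: the factor
`(i j)⁻¹` vanishes for `i = 0` or `j = 0`. -/
def invMixed (F : Series) : Series :=
  ofCoeffs fun i j s => ((i : ℂ) * j)⁻¹ * cf (i - 1) (j - 1) F s

/-- The inverse of `E (E + 2) / 2` on series without constant term, where `E` is the Euler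
operator; the constant term is sent to `0`. -/
def invEuler (F : Series) : Series :=
  ofCoeffs fun i j s => (((i : ℂ) + j) * (i + j + 2) / 2)⁻¹ * cf i j F s

theorem pderiv_pderiv_invMixed (F : Series) :
    pderiv (ℝ → ℂ) 0 (pderiv (ℝ → ℂ) 1 (invMixed F)) = F := by
  refine ext_cf fun i j => ?_
  rw [cf_pderiv_zero, cf_pderiv_one, invMixed, cf_ofCoeffs]
  funext s
  have hi : (i : ℂ) + 1 ≠ 0 := Nat.cast_add_one_ne_zero i
  have hj : (j : ℂ) + 1 ≠ 0 := Nat.cast_add_one_ne_zero j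
  simp only [Pi.mul_apply, Pi.add_apply, Pi.natCast_apply, Pi.one_apply, Nat.add_sub_cancel]
  push_cast
  field_simp

theorem AgreeBelow.invMixed {n : ℕ} {F G : Series} (h : AgreeBelow (n - 1) F G) :
    AgreeBelow (n + 1) (invMixed F) (invMixed G) := by
  rw [agreeBelow_iff] at h ⊢
  intro i j hij
  rw [NearAxis.invMixed, NearAxis.invMixed, cf_ofCoeffs, cf_ofCoeffs]
  rcases i with _ | i
  · simp
  rcases j with _ | j
  · simp
  rw [h _ _ (by omega)]

theorem AgreeBelow.invEuler {n : ℕ} {F G : Series} (h : AgreeBelow n F G) :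
    AgreeBelow n (invEuler F) (invEuler G) := by
  rw [agreeBelow_iff] at h ⊢
  intro i j hij
  rw [NearAxis.invEuler, NearAxis.invEuler, cf_ofCoeffs, cf_ofCoeffs, h _ _ hij]

theorem IsSmooth.invMixed {F : Series} (hF : IsSmooth F) : IsSmooth (invMixed F) := by
  refine isSmooth_iff.2 fun i j => ?_
  rw [NearAxis.invMixed, cf_ofCoeffs]
  exact contDiff_const.mul (hF _)

theorem IsSmooth.invEuler {F : Series} (hF : IsSmooth F) : IsSmooth (invEuler F) := by
  refine isSmooth_iff.2 fun i j => ?_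
  rw [NearAxis.invEuler, cf_ofCoeffs]
  exact contDiff_const.mul (hF _)

theorem conj_invMixed (F : Series) : conj (invMixed F) = invMixed (conj F) := by
  refine ext_cf fun i j => ?_
  rw [cf_conj, invMixed, invMixed, cf_ofCoeffs, cf_ofCoeffs, cf_conj]
  funext s
  simp [mul_comm]

theorem conj_invEuler (F : Series) : conj (invEuler F) = invEuler (conj F) := by
  refine ext_cf fun i j => ?_
  rw [cf_conj, invEuler, invEuler, cf_ofCoeffs, cf_ofCoeffs, cf_conj]
  funext s
  simp [add_comm]

section Twisted

variable {ζ : ℂ} {T : ℝ} {F : Series}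

theorem IsTwisted.invMixed (hF : IsTwisted ζ T 0 F) : IsTwisted ζ T 0 (invMixed F) := by
  rw [isTwisted_iff] at hF ⊢
  intro i j s
  rw [NearAxis.invMixed, cf_ofCoeffs]
  rcases i with _ | i
  · simp
  rcases j with _ | j
  · simp
  simp only [Nat.add_sub_cancel, hF]
  push_cast
  rw [show (i : ℤ) + 1 - (j + 1) + 0 = i - j + 0 by ring]
  exact mul_left_comm (_ : ℂ) _ _

theorem IsTwisted.invEuler (hF : IsTwisted ζ T 0 F) : IsTwisted ζ T 0 (invEuler F) := by
  rw [isTwisted_iff] at hF ⊢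
  intro i j s
  rw [NearAxis.invEuler, cf_ofCoeffs]
  simp only [hF]
  exact mul_left_comm (_ : ℂ) _ _

end Twisted

/-! ### The Beltrami equation in the transverse gauge -/

/-- The one-form `⋆d a` in the coordinates `(u, ū, s)`, in terms of `h - 1` and `h⁻¹`. -/
def field (w q : Series) (a : OneForm) : OneForm :=
  ![fn (fun _ => -Complex.I) * (q * extD a 1), fn (fun _ => -Complex.I) * (q * extD a 0),
    fn (fun _ => -(2 * Complex.I)) * ((1 + w) * extD a 2)]

theorem extD_gaugeForm_zero (αs αu : Series) :
    extD (gaugeForm αs αu) 0 = pderiv (ℝ → ℂ) 1 αs - derivS (gaugeForm αs αu 1) := rfl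

theorem extD_gaugeForm_one (αs αu : Series) :
    extD (gaugeForm αs αu) 1 = derivS (gaugeForm αs αu 0) - pderiv (ℝ → ℂ) 0 αs := rfl

theorem extD_two (a : OneForm) :
    extD a 2 = pderiv (ℝ → ℂ) 0 (a 1) - pderiv (ℝ → ℂ) 1 (a 0) := rfl

theorem gaugeForm_zero (αs αu : Series) :
    gaugeForm αs αu 0 = fn (fun _ => 1 / (4 * Complex.I)) * αu * ubarSer := rfl

theorem gaugeForm_one (αs αu : Series) :
    gaugeForm αs αu 1 = -(fn (fun _ => 1 / (4 * Complex.I)) * αu * uSer) := rfl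

/-- The lower order terms of the component along `ds` of the Beltrami equation, which reads
`∂_u ∂_ū α_s = axialSource`. -/
def axialSource (w q : Series) (k : ℝ) (αs αu : Series) : Series :=
  fn (fun _ => 1 / 2) * (pderiv (ℝ → ℂ) 0 (w * (q * pderiv (ℝ → ℂ) 1 αs))
    + pderiv (ℝ → ℂ) 1 (w * (q * pderiv (ℝ → ℂ) 0 αs))
    + pderiv (ℝ → ℂ) 0 (q * derivS (gaugeForm αs αu 1))
    + pderiv (ℝ → ℂ) 1 (q * derivS (gaugeForm αs αu 0)))
  + fn (fun _ => Complex.I / 2 * k) * extD (gaugeForm αs αu) 2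

/-- The lower order terms of the angular component of the Beltrami equation, which reads
`E (E + 2) α_u / 2 = angularSource` with the Euler operator `E`. -/
def angularSource (w q : Series) (k : ℝ) (αs αu : Series) : Series :=
  euler (w * (fn (fun _ => 2 * Complex.I) * extD (gaugeForm αs αu) 2))
  + ubarSer * derivS (field w q (gaugeForm αs αu) 1)
  + uSer * derivS (field w q (gaugeForm αs αu) 0)
  + fn (fun _ => (k : ℂ)) * (ubarSer * extD (gaugeForm αs αu) 0
    - uSer * extD (gaugeForm αs αu) 1)

theorem fn_const_mul (a b : ℂ) : fn (fun _ => a * b) = fn (fun _ => a) * fn (fun _ => b) :=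
  fn_mul (fun _ => a) (fun _ => b)

theorem fn_const_neg (a : ℂ) : fn (fun _ => -a) = -fn (fun _ => a) :=
  fn_neg (fun _ => a)

theorem fn_I_mul_fn_I : fn (fun _ => Complex.I) * fn (fun _ => Complex.I) = -1 := by
  rw [← fn_const_mul, Complex.I_mul_I, fn_const_neg]
  exact congrArg _ fn_one

theorem fn_const_two : fn (fun _ => 2) = 2 := map_ofNat C 2

theorem two_mul_fn_half : 2 * fn (fun _ => 1 / 2) = 1 := by
  rw [← fn_const_two, ← fn_const_mul, mul_one_div_cancel two_ne_zero]
  exact fn_one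

theorem fn_one_div_four_I :
    fn (fun _ => 1 / (4 * Complex.I))
      = -(fn (fun _ => Complex.I) * (fn (fun _ => 1 / 2) * fn (fun _ => 1 / 2))) := by
  rw [← fn_const_mul, ← fn_const_mul, ← fn_const_neg]
  congr 2
  funext _
  rw [one_div, mul_inv, Complex.inv_I]
  ring

/-- The axial component of `dα` is `(i / 4) (E + 2) α_u`. -/
theorem extD_gaugeForm_two (αs αu : Series) :
    extD (gaugeForm αs αu) 2
      = -(fn (fun _ => 1 / (4 * Complex.I)) * (euler αu + 2 * αu)) := by
  rw [extD_two, gaugeForm_one, gaugeForm_zero, map_neg, mul_assoc, mul_assoc, pderiv_fn_mul,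
    pderiv_fn_mul, pderiv_mul, pderiv_mul, pderiv_zero_uSer, pderiv_one_ubarSer, euler]
  ring

theorem IsSmooth.gaugeForm {αs αu : Series} (hs : IsSmooth αs) (hu : IsSmooth αu) (i : Fin 3) :
    IsSmooth (gaugeForm αs αu i) := by
  have hc : IsSmooth (fn fun _ => 1 / (4 * Complex.I)) := isSmooth_fn contDiff_const
  fin_cases i
  · exact (hc.mul hu).mul isSmooth_ubarSer
  · exact ((hc.mul hu).mul isSmooth_uSer).neg
  · exact hs

theorem IsSmooth.extD {a : OneForm} (ha : ∀ i, IsSmooth (a i)) (i : Fin 3) :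
    IsSmooth (extD a i) := by
  fin_cases i
  · exact ((ha 2).pderiv 1).sub (ha 1).derivS
  · exact (ha 0).derivS.sub ((ha 2).pderiv 0)
  · exact ((ha 1).pderiv 0).sub ((ha 0).pderiv 1)

theorem IsSmooth.field {w q : Series} {a : OneForm} (hw : IsSmooth w) (hq : IsSmooth q)
    (ha : ∀ i, IsSmooth (a i)) (i : Fin 3) : IsSmooth (field w q a i) := by
  fin_cases i
  · exact (isSmooth_fn contDiff_const).mul (hq.mul (IsSmooth.extD ha 1))
  · exact (isSmooth_fn contDiff_const).mul (hq.mul (IsSmooth.extD ha 0))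
  · exact (isSmooth_fn contDiff_const).mul ((isSmooth_one.add hw).mul (IsSmooth.extD ha 2))

/-- The exterior derivative of a smooth one-form is closed. -/
theorem closed_extD {a : OneForm} (ha : ∀ i, IsSmooth (a i)) :
    pderiv (ℝ → ℂ) 0 (extD a 0) + pderiv (ℝ → ℂ) 1 (extD a 1) + derivS (extD a 2) = 0 := by
  change pderiv (ℝ → ℂ) 0 (pderiv (ℝ → ℂ) 1 (a 2) - derivS (a 1))
    + pderiv (ℝ → ℂ) 1 (derivS (a 0) - pderiv (ℝ → ℂ) 0 (a 2))
    + derivS (pderiv (ℝ → ℂ) 0 (a 1) - pderiv (ℝ → ℂ) 1 (a 0)) = 0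
  rw [derivS_sub ((ha 1).pderiv 0) ((ha 0).pderiv 1), derivS_pderiv, derivS_pderiv, map_sub,
    map_sub, pderiv_comm]
  ring

/-- A closed two-form `G dū ∧ ds + G' ds ∧ du` whose contraction with the radial field vanishes is
zero: applying `∂_ū` and `∂_u` to `ū G = u G'` gives `(E + 1) G = 0` and `(E + 1) G' = 0`. -/
theorem eq_zero_of_divergence_free {G G' : Series} (hrad : ubarSer * G = uSer * G')
    (hdiv : pderiv (ℝ → ℂ) 0 G + pderiv (ℝ → ℂ) 1 G' = 0) : G = 0 ∧ G' = 0 := by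
  have key : ∀ F : Series, euler F + F = 0 → F = 0 := by
    intro F hF
    refine ext_cf fun i j => ?_
    have h := congrArg (cf i j) hF
    rw [map_add, cf_euler, map_zero] at h
    funext s
    have hs := congrFun h s
    simp only [Pi.add_apply, Pi.mul_apply, Pi.natCast_apply, Pi.zero_apply] at hs
    have hne : (i : ℂ) + j + 1 ≠ 0 := by
      exact_mod_cast Nat.succ_ne_zero (i + j)
    rw [map_zero]
    have hmul : ((i : ℂ) + j + 1) * cf i j F s = 0 := by linear_combination hs
    exact (mul_eq_zero.1 hmul).resolve_left hne
  have h₀ := congrArg (pderiv (ℝ → ℂ) 0) hrad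
  have h₁ := congrArg (pderiv (ℝ → ℂ) 1) hrad
  rw [pderiv_mul, pderiv_mul, pderiv_zero_uSer, pderiv_zero_ubarSer] at h₀
  rw [pderiv_mul, pderiv_mul, pderiv_one_uSer, pderiv_one_ubarSer] at h₁
  refine ⟨key G ?_, key G' ?_⟩
  · rw [euler]; linear_combination h₁ + uSer * hdiv
  · rw [euler]; linear_combination ubarSer * hdiv - h₀

section Reduction

variable {w q αs αu : Series} {k : ℝ}

/-- The axial equation for `α_s` gives the component of `d(⋆dα) = k dα` along `du ∧ dū`. -/
theorem extD_field_two (hq : (1 + w) * q = 1)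
    (h : pderiv (ℝ → ℂ) 0 (pderiv (ℝ → ℂ) 1 αs) = axialSource w q k αs αu) :
    extD (field w q (gaugeForm αs αu)) 2
      = fn (fun _ => (k : ℂ)) * extD (gaugeForm αs αu) 2 := by
  -- `q = 1 - w q` splits off the leading part `∂_u ∂_ū α_s` of both terms
  have e₀ : q * extD (gaugeForm αs αu) 0 = pderiv (ℝ → ℂ) 1 αs
      - w * (q * pderiv (ℝ → ℂ) 1 αs) - q * derivS (gaugeForm αs αu 1) := by
    rw [extD_gaugeForm_zero]; linear_combination pderiv (ℝ → ℂ) 1 αs * hq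
  have e₁ : q * extD (gaugeForm αs αu) 1 = q * derivS (gaugeForm αs αu 0)
      - (pderiv (ℝ → ℂ) 0 αs - w * (q * pderiv (ℝ → ℂ) 0 αs)) := by
    rw [extD_gaugeForm_one]; linear_combination -pderiv (ℝ → ℂ) 0 αs * hq
  have hc : fn (fun _ => Complex.I / 2 * k)
      = fn (fun _ => Complex.I) * fn (fun _ => 1 / 2) * fn (fun _ => (k : ℂ)) := by
    rw [← fn_const_mul, ← fn_const_mul]
    congr 1; funext _; ring
  have hI := fn_I_mul_fn_I
  have h2 := two_mul_fn_half
  rw [extD_two]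
  change pderiv (ℝ → ℂ) 0 (fn (fun _ => -Complex.I) * (q * extD (gaugeForm αs αu) 0))
    - pderiv (ℝ → ℂ) 1 (fn (fun _ => -Complex.I) * (q * extD (gaugeForm αs αu) 1)) = _
  rw [axialSource, hc] at h
  rw [pderiv_fn_mul, pderiv_fn_mul, e₀, e₁, fn_const_neg]
  simp only [map_sub, ← pderiv_comm]
  set X := fn (fun _ => (k : ℂ)) * extD (gaugeForm αs αu) 2
  linear_combination -2 * fn (fun _ => Complex.I) * h
    - (fn (fun _ => Complex.I) * (pderiv (ℝ → ℂ) 0 (w * (q * pderiv (ℝ → ℂ) 1 αs))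
      + pderiv (ℝ → ℂ) 1 (w * (q * pderiv (ℝ → ℂ) 0 αs))
      + pderiv (ℝ → ℂ) 0 (q * derivS (gaugeForm αs αu 1))
      + pderiv (ℝ → ℂ) 1 (q * derivS (gaugeForm αs αu 0))) - X) * h2
    - 2 * fn (fun _ => 1 / 2) * X * hI

/-- The angular equation for `α_u` gives the contraction of `d(⋆dα) = k dα` with the radial
field. -/
theorem ubarSer_mul_extD_field_sub
    (h : fn (fun _ => 1 / 2) * euler (euler αu + 2 * αu) = angularSource w q k αs αu) :
    ubarSer * extD (field w q (gaugeForm αs αu)) 0 - uSer * extD (field w q (gaugeForm αs αu)) 1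
      = fn (fun _ => (k : ℂ)) * (ubarSer * extD (gaugeForm αs αu) 0
        - uSer * extD (gaugeForm αs αu) 1) := by
  have hb : field w q (gaugeForm αs αu) 2 = fn (fun _ => 1 / 2) * (euler αu + 2 * αu)
      - w * (fn (fun _ => 2 * Complex.I) * extD (gaugeForm αs αu) 2) := by
    change fn (fun _ => -(2 * Complex.I)) * ((1 + w) * extD (gaugeForm αs αu) 2) = _
    have hI := fn_I_mul_fn_I
    have h2 := two_mul_fn_half
    rw [fn_const_neg, fn_const_mul, fn_const_two, extD_gaugeForm_two, fn_one_div_four_I]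
    linear_combination (fn (fun _ => 1 / 2) * (euler αu + 2 * αu)) * h2
      - (2 * fn (fun _ => 1 / 2) * fn (fun _ => 1 / 2) * (euler αu + 2 * αu)) * hI
  change ubarSer * (pderiv (ℝ → ℂ) 1 (field w q (gaugeForm αs αu) 2)
      - derivS (field w q (gaugeForm αs αu) 1))
    - uSer * (derivS (field w q (gaugeForm αs αu) 0)
      - pderiv (ℝ → ℂ) 0 (field w q (gaugeForm αs αu) 2)) = _
  rw [hb, map_sub, map_sub, pderiv_fn_mul, pderiv_fn_mul]
  have he : ∀ F, euler F = uSer * pderiv (ℝ → ℂ) 0 F + ubarSer * pderiv (ℝ → ℂ) 1 F :=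
    fun _ => rfl
  rw [angularSource, he (_ + _), he (w * _)] at h
  linear_combination h

/-- The axial and the angular component of the Beltrami equation imply the remaining ones. -/
theorem field_field_eq (hq : (1 + w) * q = 1) (hws : IsSmooth w) (hqs : IsSmooth q)
    (hαs : IsSmooth αs) (hαu : IsSmooth αu)
    (hax : pderiv (ℝ → ℂ) 0 (pderiv (ℝ → ℂ) 1 αs) = axialSource w q k αs αu)
    (hang : fn (fun _ => 1 / 2) * euler (euler αu + 2 * αu) = angularSource w q k αs αu) :
    field w q (field w q (gaugeForm αs αu))
      = fun i => fn (fun _ => (k : ℂ)) * field w q (gaugeForm αs αu) i := by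
  have ha := IsSmooth.gaugeForm hαs hαu
  have h₂ := extD_field_two hq hax
  have hrad := ubarSer_mul_extD_field_sub hang
  have hda := closed_extD ha
  have hdb := closed_extD (IsSmooth.field hws hqs ha)
  rw [h₂, derivS_const_mul] at hdb
  obtain ⟨h₀, h₁⟩ := eq_zero_of_divergence_free
    (G := extD (field w q (gaugeForm αs αu)) 0
      - fn (fun _ => (k : ℂ)) * extD (gaugeForm αs αu) 0)
    (G' := extD (field w q (gaugeForm αs αu)) 1
      - fn (fun _ => (k : ℂ)) * extD (gaugeForm αs αu) 1)
    (by linear_combination hrad)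
    (by rw [map_sub, map_sub, pderiv_fn_mul, pderiv_fn_mul]
        linear_combination hdb - fn (fun _ => (k : ℂ)) * hda)
  rw [sub_eq_zero] at h₀ h₁
  funext i
  fin_cases i
  · change fn (fun _ => -Complex.I) * (q * extD (field w q (gaugeForm αs αu)) 1)
      = fn (fun _ => (k : ℂ)) * (fn (fun _ => -Complex.I) * (q * extD (gaugeForm αs αu) 1))
    rw [h₁]; ring
  · change fn (fun _ => -Complex.I) * (q * extD (field w q (gaugeForm αs αu)) 0)
      = fn (fun _ => (k : ℂ)) * (fn (fun _ => -Complex.I) * (q * extD (gaugeForm αs αu) 0))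
    rw [h₀]; ring
  · change fn (fun _ => -(2 * Complex.I)) * ((1 + w) * extD (field w q (gaugeForm αs αu)) 2)
      = fn (fun _ => (k : ℂ)) * (fn (fun _ => -(2 * Complex.I))
        * ((1 + w) * extD (gaugeForm αs αu) 2))
    rw [h₂]; ring

end Reduction

/-! ### Properties of the sources -/

section Sources

variable {w q F G F' G' : Series} {k : ℝ}

theorem AgreeBelow.gaugeForm {n : ℕ} (h : AgreeBelow n G G') {i : Fin 3} (hi : i ≠ 2) :
    AgreeBelow (n + 1) (gaugeForm F G i) (gaugeForm F' G' i) := by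
  fin_cases i
  · change AgreeBelow (n + 1) (fn _ * G * ubarSer) (fn _ * G' * ubarSer)
    rw [mul_comm _ ubarSer, mul_comm _ ubarSer]
    exact (h.mul_left _).ubarSer_mul
  · change AgreeBelow (n + 1) (-(fn _ * G * uSer)) (-(fn _ * G' * uSer))
    rw [mul_comm _ uSer, mul_comm _ uSer]
    exact ((h.mul_left _).uSer_mul).neg
  · exact absurd rfl hi

theorem AgreeBelow.extD_gaugeForm {n : ℕ} (h : AgreeBelow (n + 1) F F') (h' : AgreeBelow n G G')
    (i : Fin 3) : AgreeBelow n (extD (NearAxis.gaugeForm F G) i)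
      (extD (NearAxis.gaugeForm F' G') i) := by
  have h0 := AgreeBelow.gaugeForm (F := F) (F' := F') h' (i := 0) (by decide)
  have h1 := AgreeBelow.gaugeForm (F := F) (F' := F') h' (i := 1) (by decide)
  fin_cases i
  · exact (h.pderiv 1).sub (h1.derivS.mono (Nat.le_succ n))
  · exact (h0.derivS.mono (Nat.le_succ n)).sub (h.pderiv 0)
  · exact (h1.pderiv 0).sub (h0.pderiv 1)

theorem AgreeBelow.extD_gaugeForm_two {n : ℕ} (h' : AgreeBelow n G G') :
    AgreeBelow n (extD (NearAxis.gaugeForm F G) 2) (extD (NearAxis.gaugeForm F' G') 2) := by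
  have h0 := AgreeBelow.gaugeForm (F := F) (F' := F') h' (i := 0) (by decide)
  have h1 := AgreeBelow.gaugeForm (F := F) (F' := F') h' (i := 1) (by decide)
  exact (h1.pderiv 0).sub (h0.pderiv 1)

theorem AgreeBelow.euler {n : ℕ} (h : AgreeBelow n F G) :
    AgreeBelow n (euler F) (euler G) := by
  rw [agreeBelow_iff] at h ⊢
  intro i j hij
  rw [cf_euler, cf_euler, h i j hij]

/-- The second order derivatives of `α_s` only enter with the factor `w`, which gains one order. -/
theorem AgreeBelow.axialSource {n : ℕ}
    (hw : ∀ n F G, AgreeBelow n F G → AgreeBelow (n + 1) (w * F) (w * G))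
    (h : AgreeBelow n F F') (h' : AgreeBelow n G G') :
    AgreeBelow (n - 1) (axialSource w q k F G) (axialSource w q k F' G') := by
  have h0 := (AgreeBelow.gaugeForm (F := F) (F' := F') h' (i := 0) (by decide)).mono (Nat.le_succ n)
  have h1 := (AgreeBelow.gaugeForm (F := F) (F' := F') h' (i := 1) (by decide)).mono (Nat.le_succ n)
  have hd : ∀ i, AgreeBelow n (w * (q * MvPowerSeries.pderiv (ℝ → ℂ) i F))
      (w * (q * MvPowerSeries.pderiv (ℝ → ℂ) i F')) := fun i =>
    (hw _ _ _ ((h.pderiv i).mul_left q)).mono (by omega)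
  exact (((((((hd 1).pderiv 0).add ((hd 0).pderiv 1)).add ((h1.derivS.mul_left q).pderiv 0)).add
    ((h0.derivS.mul_left q).pderiv 1)).mul_left _)).add
    (((AgreeBelow.extD_gaugeForm_two h').mul_left _).mono (Nat.sub_le n 1))

theorem AgreeBelow.angularSource {n : ℕ}
    (hw : ∀ n F G, AgreeBelow n F G → AgreeBelow (n + 1) (w * F) (w * G))
    (h : AgreeBelow (n + 1) F F') (h' : AgreeBelow n G G') :
    AgreeBelow (n + 1) (angularSource w q k F G) (angularSource w q k F' G') := by
  have hd := AgreeBelow.extD_gaugeForm h h'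
  exact ((((hw _ _ _ ((hd 2).mul_left _)).euler).add
    (((hd 0).mul_left q).mul_left _).derivS.ubarSer_mul).add
    (((hd 1).mul_left q).mul_left _).derivS.uSer_mul).add
    (((hd 0).ubarSer_mul.sub (hd 1).uSer_mul).mul_left _)

theorem IsSmooth.euler (hF : IsSmooth F) : IsSmooth (euler F) :=
  (isSmooth_uSer.mul (hF.pderiv 0)).add (isSmooth_ubarSer.mul (hF.pderiv 1))

theorem IsSmooth.axialSource (hw : IsSmooth w) (hq : IsSmooth q) (hF : IsSmooth F)
    (hG : IsSmooth G) : IsSmooth (axialSource w q k F G) := by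
  have ha := IsSmooth.gaugeForm hF hG
  exact ((isSmooth_fn contDiff_const).mul (((((hw.mul (hq.mul (hF.pderiv 1))).pderiv 0).add
    ((hw.mul (hq.mul (hF.pderiv 0))).pderiv 1)).add ((hq.mul (ha 1).derivS).pderiv 0)).add
    ((hq.mul (ha 0).derivS).pderiv 1))).add
    ((isSmooth_fn contDiff_const).mul (IsSmooth.extD ha 2))

theorem IsSmooth.angularSource (hw : IsSmooth w) (hq : IsSmooth q) (hF : IsSmooth F)
    (hG : IsSmooth G) : IsSmooth (angularSource w q k F G) := by
  have ha := IsSmooth.gaugeForm hF hG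
  have hd := IsSmooth.extD ha
  have hb := IsSmooth.field hw hq ha
  exact ((((hw.mul ((isSmooth_fn contDiff_const).mul (hd 2))).euler).add
    (isSmooth_ubarSer.mul (hb 1).derivS)).add (isSmooth_uSer.mul (hb 0).derivS)).add
    ((isSmooth_fn contDiff_const).mul ((isSmooth_ubarSer.mul (hd 0)).sub
      (isSmooth_uSer.mul (hd 1))))

theorem conj_fn_const (c : ℂ) : conj (fn fun _ => c) = fn fun _ => star c := conj_fn _

theorem conj_derivS_gaugeForm_zero :
    conj (derivS (gaugeForm F G 0)) = derivS (gaugeForm (conj F) (conj G) 1) := by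
  have hc : star (1 / (4 * Complex.I)) = -(1 / (4 * Complex.I)) := by
    simp
  rw [conj_derivS, gaugeForm_zero, gaugeForm_one, map_mul, map_mul, conj_fn_const, hc,
    fn_const_neg, conj_ubarSer]
  congr 1
  ring

theorem conj_derivS_gaugeForm_one :
    conj (derivS (gaugeForm F G 1)) = derivS (gaugeForm (conj F) (conj G) 0) := by
  have hc : star (1 / (4 * Complex.I)) = -(1 / (4 * Complex.I)) := by
    simp
  rw [conj_derivS, gaugeForm_zero, gaugeForm_one, map_neg, map_mul, map_mul, conj_fn_const, hc,
    fn_const_neg, conj_uSer]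
  congr 1
  ring

theorem conj_extD_gaugeForm_zero :
    conj (extD (gaugeForm F G) 0) = -extD (gaugeForm (conj F) (conj G)) 1 := by
  rw [extD_gaugeForm_zero, extD_gaugeForm_one, map_sub, conj_derivS_gaugeForm_one,
    conj_pderiv_one]
  ring

theorem conj_extD_gaugeForm_one :
    conj (extD (gaugeForm F G) 1) = -extD (gaugeForm (conj F) (conj G)) 0 := by
  rw [extD_gaugeForm_zero, extD_gaugeForm_one, map_sub, conj_derivS_gaugeForm_zero,
    conj_pderiv_zero]
  ring

theorem conj_euler : conj (euler F) = euler (conj F) := by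
  simp only [euler, map_add, map_mul, conj_uSer, conj_ubarSer, conj_pderiv_zero, conj_pderiv_one]
  ring

theorem conj_extD_gaugeForm_two :
    conj (extD (gaugeForm F G) 2) = -extD (gaugeForm (conj F) (conj G)) 2 := by
  have hc : star (1 / (4 * Complex.I)) = -(1 / (4 * Complex.I)) := by
    simp
  rw [extD_gaugeForm_two, extD_gaugeForm_two, map_neg, map_mul, map_add, conj_euler, map_mul,
    conj_fn_const, hc, fn_const_neg, map_ofNat]
  ring

theorem conj_axialSource (hw : conj w = w) (hq : conj q = q) :
    conj (axialSource w q k F G) = axialSource w q k (conj F) (conj G) := by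
  have h₁ : star (1 / 2 : ℂ) = 1 / 2 := by simp
  have h₂ : star (Complex.I / 2 * k) = -(Complex.I / 2 * k) := by simp; ring
  simp only [axialSource, map_add, map_mul, conj_fn_const, h₁, h₂, fn_const_neg, hw, hq,
    conj_pderiv_zero, conj_pderiv_one, conj_derivS_gaugeForm_one, conj_derivS_gaugeForm_zero,
    conj_extD_gaugeForm_two]
  ring

theorem conj_field_zero (hq : conj q = q) :
    conj (field w q (gaugeForm F G) 0) = field w q (gaugeForm (conj F) (conj G)) 1 := by
  change conj (fn (fun _ => -Complex.I) * (q * extD (gaugeForm F G) 1))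
    = fn (fun _ => -Complex.I) * (q * extD (gaugeForm (conj F) (conj G)) 0)
  rw [map_mul, map_mul, hq, conj_extD_gaugeForm_one, conj_fn_const, star_neg, fn_const_neg,
    fn_const_neg, Complex.star_def, Complex.conj_I, fn_const_neg]
  ring

theorem conj_field_one (hq : conj q = q) :
    conj (field w q (gaugeForm F G) 1) = field w q (gaugeForm (conj F) (conj G)) 0 := by
  change conj (fn (fun _ => -Complex.I) * (q * extD (gaugeForm F G) 0))
    = fn (fun _ => -Complex.I) * (q * extD (gaugeForm (conj F) (conj G)) 1)
  rw [map_mul, map_mul, hq, conj_extD_gaugeForm_zero, conj_fn_const, star_neg, fn_const_neg,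
    fn_const_neg, Complex.star_def, Complex.conj_I, fn_const_neg]
  ring

theorem conj_angularSource (hw : conj w = w) (hq : conj q = q) :
    conj (angularSource w q k F G) = angularSource w q k (conj F) (conj G) := by
  have h₁ : star (k : ℂ) = k := by simp
  have h₂ : star (2 * Complex.I) = -(2 * Complex.I) := by simp
  simp only [angularSource, map_add, map_sub, map_mul, conj_euler, conj_derivS, conj_field_zero hq,
    conj_field_one hq, conj_extD_gaugeForm_zero, conj_extD_gaugeForm_one, conj_extD_gaugeForm_two,
    hw, conj_fn_const, h₁, h₂, fn_const_neg, conj_uSer, conj_ubarSer, neg_mul_neg]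
  ring

variable {ζ : ℂ} {T : ℝ}

theorem IsTwisted.gaugeForm_zero (hζ : ζ ≠ 0) (hG : IsTwisted ζ T 0 G) :
    IsTwisted ζ T 1 (gaugeForm F G 0) :=
  (((isTwisted_const _).mul hζ hG).mul hζ isTwisted_ubarSer).of_weight_eq (by norm_num)

theorem IsTwisted.gaugeForm_one (hζ : ζ ≠ 0) (hG : IsTwisted ζ T 0 G) :
    IsTwisted ζ T (-1) (gaugeForm F G 1) :=
  ((((isTwisted_const _).mul hζ hG).mul hζ isTwisted_uSer).of_weight_eq (by norm_num)).neg

theorem IsTwisted.extD_gaugeForm_zero (hζ : ζ ≠ 0) (hF : IsTwisted ζ T 0 F)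
    (hG : IsTwisted ζ T 0 G) : IsTwisted ζ T (-1) (extD (gaugeForm F G) 0) :=
  (hF.pderiv_one.of_weight_eq (by norm_num)).sub (hG.gaugeForm_one hζ).derivS

theorem IsTwisted.extD_gaugeForm_one (hζ : ζ ≠ 0) (hF : IsTwisted ζ T 0 F)
    (hG : IsTwisted ζ T 0 G) : IsTwisted ζ T 1 (extD (gaugeForm F G) 1) :=
  (hG.gaugeForm_zero hζ).derivS.sub (hF.pderiv_zero.of_weight_eq (by norm_num))

theorem IsTwisted.extD_gaugeForm_two (hζ : ζ ≠ 0)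
    (hG : IsTwisted ζ T 0 G) : IsTwisted ζ T 0 (extD (gaugeForm F G) 2) :=
  ((hG.gaugeForm_one hζ).pderiv_zero.of_weight_eq (by norm_num)).sub
    ((hG.gaugeForm_zero hζ).pderiv_one.of_weight_eq (by norm_num))

theorem IsTwisted.euler (hF : IsTwisted ζ T 0 F) : IsTwisted ζ T 0 (euler F) := by
  rw [isTwisted_iff] at hF ⊢
  intro i j s
  rw [cf_euler]
  simp only [Pi.mul_apply, Pi.add_apply, Pi.natCast_apply, hF]
  exact mul_left_comm (_ : ℂ) _ _

theorem IsTwisted.zero_mul {v : ℤ} (hζ : ζ ≠ 0) (hF : IsTwisted ζ T 0 F)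
    (hG : IsTwisted ζ T v G) : IsTwisted ζ T v (F * G) :=
  (hF.mul hζ hG).of_weight_eq (zero_add v)

theorem IsTwisted.axialSource (hζ : ζ ≠ 0) (hw : IsTwisted ζ T 0 w) (hq : IsTwisted ζ T 0 q)
    (hF : IsTwisted ζ T 0 F) (hG : IsTwisted ζ T 0 G) :
    IsTwisted ζ T 0 (axialSource w q k F G) := by
  refine ((isTwisted_const _).zero_mul hζ (((IsTwisted.add ?_ ?_).add ?_).add ?_)).add
    ((isTwisted_const _).zero_mul hζ (hG.extD_gaugeForm_two hζ))
  · exact (hw.zero_mul hζ (hq.zero_mul hζ hF.pderiv_one)).pderiv_zero.of_weight_eq (by norm_num)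
  · exact (hw.zero_mul hζ (hq.zero_mul hζ hF.pderiv_zero)).pderiv_one.of_weight_eq (by norm_num)
  · exact (hq.zero_mul hζ (hG.gaugeForm_one hζ).derivS).pderiv_zero.of_weight_eq (by norm_num)
  · exact (hq.zero_mul hζ (hG.gaugeForm_zero hζ).derivS).pderiv_one.of_weight_eq (by norm_num)

theorem IsTwisted.angularSource (hζ : ζ ≠ 0) (hw : IsTwisted ζ T 0 w) (hq : IsTwisted ζ T 0 q)
    (hF : IsTwisted ζ T 0 F) (hG : IsTwisted ζ T 0 G) :
    IsTwisted ζ T 0 (angularSource w q k F G) := by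
  have h₀ := hF.extD_gaugeForm_zero hζ hG
  have h₁ := hF.extD_gaugeForm_one hζ hG
  have hu : ∀ {H : Series}, IsTwisted ζ T 1 H → IsTwisted ζ T 0 (uSer * H) :=
    fun h => (isTwisted_uSer.mul hζ h).of_weight_eq (by norm_num)
  have hubar : ∀ {H : Series}, IsTwisted ζ T (-1) H → IsTwisted ζ T 0 (ubarSer * H) :=
    fun h => (isTwisted_ubarSer.mul hζ h).of_weight_eq (by norm_num)
  exact (((hw.zero_mul hζ ((isTwisted_const _).zero_mul hζ (hG.extD_gaugeForm_two hζ))).euler.add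
    (hubar ((isTwisted_const _).zero_mul hζ (hq.zero_mul hζ h₀)).derivS)).add
    (hu ((isTwisted_const _).zero_mul hζ (hq.zero_mul hζ h₁)).derivS)).add
    ((isTwisted_const _).zero_mul hζ ((hubar h₀).sub (hu h₁)))

theorem cf_zero_zero_angularSource : cf 0 0 (angularSource w q k F G) = 0 := by
  simp [angularSource, cf_euler]

/-- Since `E (E + 2) / 2` annihilates functions of `s` and inverts `invEuler` off the constant
term, the constant term of the source has to vanish. -/
theorem euler_eq_of_fixedPoint {B : ℝ → ℂ} {H : Series} (hH : cf 0 0 H = 0)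
    (hG : G = fn B + invEuler H) :
    fn (fun _ => 1 / 2) * euler (euler G + 2 * G) = H := by
  refine ext_cf fun i j => ?_
  have h2 : cf i j (2 * G) = (fun _ => 2) * cf i j G := by
    rw [← fn_const_two, cf_fn_mul]
  rw [cf_fn_mul, cf_euler, map_add, cf_euler, h2, hG, map_add, cf_fn, invEuler, cf_ofCoeffs]
  funext s
  simp only [Pi.mul_apply, Pi.add_apply, Pi.natCast_apply]
  by_cases hij : i = 0 ∧ j = 0
  · obtain ⟨rfl, rfl⟩ := hij
    rw [hH]
    simp
  · rw [if_neg hij]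
    have h₁ : (i : ℂ) + j ≠ 0 := by
      exact_mod_cast (by omega : i + j ≠ 0)
    have h₂ : (i : ℂ) + j + 2 ≠ 0 := by
      exact_mod_cast (by omega : i + j + 2 ≠ 0)
    simp only [Pi.zero_apply, zero_add]
    field_simp

end Sources

/-! ### The variables `z` and `z̄` -/

section ZVariables

variable {γ : ℝ → ℝ}

/-- The coefficients of a series in the variables `z`, `z̄`. -/
def toCoeffs (γ : ℝ → ℝ) (F : Series) : Coeffs :=
  fun p s => cf p.1 p.2 F s * Complex.exp (Complex.I * ((p.1 : ℂ) - p.2) * γ s)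

theorem cf_fn_mul_zSer_pow (f : ℝ → ℂ) (a b i j : ℕ) :
    cf i j (fn f * zSer γ ^ a * zbarSer γ ^ b) = if (a, b) = (i, j) then
      (fun s => f s * Complex.exp (-(Complex.I * ((a : ℂ) - b) * γ s))) else 0 := by
  classical
  have h : uSer ^ a * ubarSer ^ b = monomial (expo a b) 1 := by
    rw [uSer, ubarSer, X_pow_eq, X_pow_eq, monomial_mul_monomial, one_mul, expo]
  have h' : fn f * zSer γ ^ a * zbarSer γ ^ b
      = fn (fun s => f s * Complex.exp (-(Complex.I * ((a : ℂ) - b) * γ s)))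
        * (uSer ^ a * ubarSer ^ b) := by
    have e : (fun s => f s * Complex.exp (-(Complex.I * ((a : ℂ) - b) * γ s)))
        = f * (fun s => Complex.exp (-(Complex.I * (γ s : ℂ)))) ^ a
          * (fun s => Complex.exp (Complex.I * (γ s : ℂ))) ^ b := by
      funext s
      simp only [Pi.mul_apply, Pi.pow_apply, ← Complex.exp_nat_mul, mul_assoc, ← Complex.exp_add]
      congr 2
      ring
    rw [e, fn_mul, fn_mul, zSer, zbarSer, mul_pow, mul_pow,
      show ∀ (g : ℝ → ℂ) n, fn (g ^ n) = fn g ^ n from fun g n => map_pow C g n,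
      show ∀ (g : ℝ → ℂ) n, fn (g ^ n) = fn g ^ n from fun g n => map_pow C g n]
    ring
  rw [h', h, cf_fn_mul, cf, coeff_monomial]
  have hiff : expo i j = expo a b ↔ (a, b) = (i, j) := by
    constructor
    · intro he
      have h0 := DFunLike.congr_fun he 0
      have h1 := DFunLike.congr_fun he 1
      rw [expo_zero, expo_zero] at h0
      rw [expo_one, expo_one] at h1
      rw [h0, h1]
    · intro he
      rw [(Prod.mk.inj he).1, (Prod.mk.inj he).2]
  by_cases hij : (a, b) = (i, j)
  · rw [if_pos (hiff.2 hij), if_pos hij, mul_one]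
  · rw [if_neg (fun he => hij (hiff.1 he)), if_neg hij, mul_zero]

theorem zPoly_toCoeffs (γ : ℝ → ℝ) (n : ℕ) (F : Series) :
    zPoly γ n (toCoeffs γ F) = homPart n F := by
  refine ext_cf fun i j => ?_
  rw [zPoly, map_sum, cf_homPart]
  simp only [cf_fn_mul_zSer_pow]
  have : ∀ p : ℕ × ℕ, (if (p.1, p.2) = (i, j) then (fun s => toCoeffs γ F p s
      * Complex.exp (-(Complex.I * ((p.1 : ℂ) - p.2) * γ s))) else 0)
      = if p = (i, j) then cf i j F else 0 := by
    intro p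
    by_cases hp : p = (i, j)
    · subst hp
      rw [if_pos rfl, if_pos rfl]
      funext s
      rw [toCoeffs, mul_assoc, ← Complex.exp_add, add_neg_cancel, Complex.exp_zero, mul_one]
    · rw [if_neg hp, if_neg hp]
  rw [Finset.sum_congr rfl fun p _ => this p, Finset.sum_ite_eq']
  simp [Finset.HasAntidiagonal.mem_antidiagonal]

theorem isRealCoeffs_toCoeffs (hγ : ContDiff ℝ ∞ γ) {F : Series} (hF : IsSmooth F)
    (hF' : conj F = F) : IsRealCoeffs (toCoeffs γ F) := by
  constructor
  · intro p
    exact (hF _).mul (Complex.contDiff_exp.comp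
      (contDiff_const.mul (Complex.ofRealCLM.contDiff.comp hγ)))
  · intro i j s
    have h : cf j i F s = star (cf i j F s) := by
      conv_lhs => rw [← hF', cf_conj]
      rfl
    simp only [toCoeffs]
    rw [h, star_mul', Complex.star_def, ← Complex.exp_conj]
    congr 2
    simp only [map_mul, map_sub, Complex.conj_I, Complex.conj_ofReal, map_natCast]
    ring

theorem isPeriodicCoeffs_toCoeffs {T γ₀ : ℝ} (hγT : ∀ s, γ (T + s) - γ s = γ₀) {F : Series}
    (hF : IsTwisted (Complex.exp (-(Complex.I * γ₀))) T 0 F) :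
    IsPeriodicCoeffs T (toCoeffs γ F) := by
  rw [isTwisted_iff] at hF
  intro p s
  have hg : γ (s + T) = γ s + γ₀ := by rw [← hγT s, add_comm s T]; ring
  simp only [toCoeffs]
  rw [hF, hg, add_zero, ← Complex.exp_int_mul, mul_right_comm, ← Complex.exp_add, mul_comm]
  congr 2
  push_cast
  ring

/-- The real series `∑ (A_n z ^ n + Ā_n z̄ ^ n)`, the general real solution of `∂_u ∂_ū F = 0`. -/
def harmonicSer (γ : ℝ → ℝ) (A : ℕ → ℝ → ℂ) : Series :=
  ofCoeffs fun i j s =>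
    (if j = 0 then A i s * Complex.exp (-(Complex.I * i * γ s)) else 0)
      + if i = 0 then star (A j s) * Complex.exp (Complex.I * j * γ s) else 0

theorem homPart_harmonicSer (γ : ℝ → ℝ) (A : ℕ → ℝ → ℂ) (n : ℕ) :
    homPart n (harmonicSer γ A)
      = fn (A n) * zSer γ ^ n + fn (fun s => star (A n s)) * zbarSer γ ^ n := by
  have h₁ : fn (A n) * zSer γ ^ n = fn (A n) * zSer γ ^ n * zbarSer γ ^ 0 := by
    rw [pow_zero, mul_one]
  have h₂ : fn (fun s => star (A n s)) * zbarSer γ ^ n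
      = fn (fun s => star (A n s)) * zSer γ ^ 0 * zbarSer γ ^ n := by
    rw [pow_zero, mul_one]
  refine ext_cf fun i j => ?_
  rw [h₁, h₂, map_add, cf_fn_mul_zSer_pow, cf_fn_mul_zSer_pow, cf_homPart, harmonicSer, cf_ofCoeffs]
  simp only [Prod.mk.injEq]
  funext s
  by_cases hn : i + j = n
  · rw [if_pos hn]
    subst hn
    rcases i with _ | i <;> rcases j with _ | j <;> simp
    left
    congr 1
    ring
  · rw [if_neg hn, if_neg (by omega), if_neg (by omega)]
    simp

theorem pderiv_pderiv_harmonicSer (γ : ℝ → ℝ) (A : ℕ → ℝ → ℂ) :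
    pderiv (ℝ → ℂ) 0 (pderiv (ℝ → ℂ) 1 (harmonicSer γ A)) = 0 := by
  refine ext_cf fun i j => ?_
  rw [cf_pderiv_zero, cf_pderiv_one, harmonicSer, cf_ofCoeffs, map_zero]
  funext s
  simp

theorem isSmooth_harmonicSer (hγ : ContDiff ℝ ∞ γ) {A : ℕ → ℝ → ℂ} (hA : ∀ n, ContDiff ℝ ∞ (A n)) :
    IsSmooth (harmonicSer γ A) := by
  have hγ' : ContDiff ℝ ∞ fun s => (γ s : ℂ) := Complex.ofRealCLM.contDiff.comp hγ
  refine isSmooth_iff.2 fun i j => ?_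
  rw [harmonicSer, cf_ofCoeffs]
  refine ContDiff.add ?_ ?_
  · split_ifs
    · exact (hA i).mul (Complex.contDiff_exp.comp (contDiff_const.mul hγ').neg)
    · exact contDiff_const
  · split_ifs
    · exact (hA j).star_complex.mul (Complex.contDiff_exp.comp (contDiff_const.mul hγ'))
    · exact contDiff_const

theorem conj_harmonicSer (γ : ℝ → ℝ) (A : ℕ → ℝ → ℂ) :
    conj (harmonicSer γ A) = harmonicSer γ A := by
  refine ext_cf fun i j => ?_
  rw [cf_conj, harmonicSer, cf_ofCoeffs, cf_ofCoeffs]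
  funext s
  have h : ∀ n : ℕ, star (Complex.exp (-(Complex.I * n * γ s)))
      = Complex.exp (Complex.I * n * γ s) := by
    intro n
    rw [Complex.star_def, ← Complex.exp_conj]
    simp
  have h' : ∀ n : ℕ, star (Complex.exp (Complex.I * n * γ s))
      = Complex.exp (-(Complex.I * n * γ s)) := by
    intro n; rw [← h, star_star]
  simp only [Pi.star_apply, star_add, apply_ite star, star_zero, star_mul', star_star, h, h']
  exact add_comm _ _

theorem isTwisted_below_harmonicSer {T γ₀ : ℝ} (hγT : ∀ s, γ (T + s) - γ s = γ₀) {A : ℕ → ℝ → ℂ}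
    {N : ℕ} (hA : ∀ j < N, Function.Periodic (A j) T) :
    IsTwisted (Complex.exp (-(Complex.I * γ₀))) T 0 (below N (harmonicSer γ A)) := by
  refine isTwisted_iff.2 fun i j s => ?_
  have hg : γ (s + T) = γ s + γ₀ := by rw [← hγT s, add_comm s T]; ring
  rw [cf, coeff_below, degree_expo]
  split_ifs with hij
  · change cf i j (harmonicSer γ A) _ = _ * cf i j (harmonicSer γ A) _
    rw [harmonicSer, cf_ofCoeffs, add_zero, mul_add, hg, ← Complex.exp_int_mul, hA i (by omega),
      hA j (by omega)]
    congr 1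
    · split_ifs with h
      · rw [mul_left_comm, ← Complex.exp_add, h]
        congr 2
        push_cast
        ring
      · rw [mul_zero]
    · split_ifs with h
      · rw [mul_left_comm, ← Complex.exp_add, h]
        congr 2
        push_cast
        ring
      · rw [mul_zero]
  · simp

end ZVariables

/-! ### Homogeneous parts -/

theorem below_add (n : ℕ) (F G : Series) : below n (F + G) = below n F + below n G := by
  refine MvPowerSeries.ext fun m => ?_
  rw [map_add, coeff_below, coeff_below, coeff_below, map_add]
  split_ifs
  · rfl
  · rw [add_zero]

theorem homPart_add (n : ℕ) (F G : Series) : homPart n (F + G) = homPart n F + homPart n G := by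
  refine MvPowerSeries.ext fun m => ?_
  rw [map_add, coeff_homPart, coeff_homPart, coeff_homPart, map_add]
  split_ifs
  · rfl
  · rw [add_zero]

theorem homPart_zero_eq_fn (F : Series) : homPart 0 F = fn (cf 0 0 F) := by
  refine ext_cf fun i j => ?_
  rw [cf_homPart, cf_fn]
  by_cases h : i = 0 ∧ j = 0
  · obtain ⟨rfl, rfl⟩ := h
    simp
  · rw [if_neg h, if_neg (by omega)]

theorem homPart_one_eq_zero {F : Series} (h₁ : cf 1 0 F = 0) (h₂ : cf 0 1 F = 0) :
    homPart 1 F = 0 := by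
  refine ext_cf fun i j => ?_
  rw [cf_homPart, map_zero]
  split_ifs with h
  · rcases i with _ | i
    · rwa [show j = 1 by omega]
    · rwa [show i = 0 by omega, show j = 0 by omega]
  · rfl

/-! ### The field on the axis -/

section Axis

variable {T : ℝ} {r n₁ n₂ : ℝ → Fin 3 → ℝ}

theorem starD_eq_field (hr : IsClosedArcLengthCurve T r) (hn : IsBishopFrame r n₁ n₂)
    (a : OneForm) : starD r n₁ n₂ a = field (scaleDefect r n₁ n₂) (scaleInv r n₁ n₂) a :=
  starD_eq hr hn a

theorem constantCoeff_derivS_gaugeForm (αs αu : Series) :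
    constantCoeff (derivS (gaugeForm αs αu 0)) = 0 ∧
      constantCoeff (derivS (gaugeForm αs αu 1)) = 0 := by
  have h : ∀ F : Series, constantCoeff F = 0 → constantCoeff (derivS F) = 0 := by
    intro F hF
    rw [← coeff_zero_eq_constantCoeff_apply] at hF ⊢
    rw [coeff_derivS, hF]
    exact deriv_const' 0
  constructor
  · apply h; simp [gaugeForm_zero, ubarSer]
  · apply h; simp [gaugeForm_one, uSer]

/-- On the axis, `⋆dα` is `α_u⁰ ds` plus terms linear in the first order part of `α_s`. -/
theorem onAxisField_iff (hr : IsClosedArcLengthCurve T r) (hn : IsBishopFrame r n₁ n₂)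
    (αs αu : Series) (B₀ : ℝ → ℝ) :
    OnAxisField r n₁ n₂ (gaugeForm αs αu) B₀ ↔
      cf 1 0 αs = 0 ∧ cf 0 1 αs = 0 ∧ cf 0 0 αu = fun s => (B₀ s : ℂ) := by
  have hd := constantCoeff_derivS_gaugeForm αs αu
  have hp₀ : constantCoeff (pderiv (ℝ → ℂ) 0 αs) = cf 1 0 αs := by
    rw [← cf_zero_zero, cf_pderiv_zero]; simp
  have hp₁ : constantCoeff (pderiv (ℝ → ℂ) 1 αs) = cf 0 1 αs := by
    rw [← cf_zero_zero, cf_pderiv_one]; simp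
  have hfn : ∀ f, constantCoeff (fn f) = f := fun f => constantCoeff_C f
  have he : constantCoeff (euler αu) = 0 := by
    rw [← cf_zero_zero, cf_euler]; simp
  have h₀ : constantCoeff (starD r n₁ n₂ (gaugeForm αs αu) 0)
      = (fun _ => Complex.I) * cf 1 0 αs := by
    rw [starD_eq_field hr hn]
    change constantCoeff (fn (fun _ => -Complex.I)
      * (scaleInv r n₁ n₂ * extD (gaugeForm αs αu) 1)) = _
    rw [map_mul, map_mul, constantCoeff_scaleInv, extD_gaugeForm_one, map_sub, hd.1, hp₀, hfn]
    funext s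
    simp
  have h₁ : constantCoeff (starD r n₁ n₂ (gaugeForm αs αu) 1)
      = (fun _ => -Complex.I) * cf 0 1 αs := by
    rw [starD_eq_field hr hn]
    change constantCoeff (fn (fun _ => -Complex.I)
      * (scaleInv r n₁ n₂ * extD (gaugeForm αs αu) 0)) = _
    rw [map_mul, map_mul, constantCoeff_scaleInv, extD_gaugeForm_zero, map_sub, hd.2, hp₁, hfn]
    funext s
    simp
  have h₂ : constantCoeff (starD r n₁ n₂ (gaugeForm αs αu) 2) = cf 0 0 αu := by
    rw [starD_eq_field hr hn]
    change constantCoeff (fn (fun _ => -(2 * Complex.I))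
      * ((1 + scaleDefect r n₁ n₂) * extD (gaugeForm αs αu) 2)) = _
    rw [map_mul, map_mul, map_add, constantCoeff_scaleDefect, extD_gaugeForm_two, map_neg, map_mul,
      map_add, he, map_mul, hfn, hfn, cf_zero_zero]
    funext s
    simp only [map_one, map_ofNat, Pi.mul_apply, Pi.add_apply, Pi.neg_apply, Pi.ofNat_apply]
    have hI : Complex.I ≠ 0 := Complex.I_ne_zero
    field_simp
    ring
  have hcancel : ∀ (c : ℂ) (f : ℝ → ℂ), c ≠ 0 → ((fun _ => c) * f = 0 ↔ f = 0) := by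
    intro c f hc
    constructor
    · intro h
      funext s
      exact (mul_eq_zero.1 (congrFun h s)).resolve_left hc
    · rintro rfl
      exact mul_zero _
  rw [OnAxisField, h₀, h₁, h₂, hcancel _ _ Complex.I_ne_zero,
    hcancel _ _ (neg_ne_zero.2 Complex.I_ne_zero)]

/-- `⋆dα` does not see the part of `α_s` that depends on `s` only. -/
theorem starD_gaugeForm_sub_fn (r n₁ n₂ : ℝ → Fin 3 → ℝ) (αs αu : Series) (f : ℝ → ℂ) :
    starD r n₁ n₂ (gaugeForm (αs - fn f) αu) = starD r n₁ n₂ (gaugeForm αs αu) := by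
  have h₀ : extD (gaugeForm (αs - fn f) αu) 0 = extD (gaugeForm αs αu) 0 := by
    rw [extD_gaugeForm_zero, extD_gaugeForm_zero, gaugeForm_one, gaugeForm_one, map_sub,
      pderiv_fn, sub_zero]
  have h₁ : extD (gaugeForm (αs - fn f) αu) 1 = extD (gaugeForm αs αu) 1 := by
    rw [extD_gaugeForm_one, extD_gaugeForm_one, gaugeForm_zero, gaugeForm_zero, map_sub,
      pderiv_fn, sub_zero]
  have h₂ : extD (gaugeForm (αs - fn f) αu) 2 = extD (gaugeForm αs αu) 2 := by
    rw [extD_gaugeForm_two, extD_gaugeForm_two]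
  funext i
  rw [starD, starD, Fin.sum_univ_three, Fin.sum_univ_three, h₀, h₁, h₂]

end Axis

/-! ### The formal solution -/

section Solution

variable {T k γ₀ : ℝ} {r n₁ n₂ : ℝ → Fin 3 → ℝ} {γ : ℝ → ℝ} {A : ℕ → ℝ → ℂ} {B₀ : ℝ → ℝ}
  {αs αu : Series}

/-- The operator computing `α_s` from `α_s` and `α_u` of lower order. -/
def axialStep (r n₁ n₂ : ℝ → Fin 3 → ℝ) (k : ℝ) (γ : ℝ → ℝ) (A : ℕ → ℝ → ℂ)
    (αs αu : Series) : Series :=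
  harmonicSer γ A + invMixed (axialSource (scaleDefect r n₁ n₂) (scaleInv r n₁ n₂) k αs αu)

/-- The operator computing `α_u` from `α_s` up to the same order and `α_u` of lower order. -/
def angularStep (r n₁ n₂ : ℝ → Fin 3 → ℝ) (k : ℝ) (B₀ : ℝ → ℝ) (αs αu : Series) : Series :=
  fn (fun s => (B₀ s : ℂ))
    + invEuler (angularSource (scaleDefect r n₁ n₂) (scaleInv r n₁ n₂) k αs αu)

theorem agreeBelow_invMixed_axialSource (r n₁ n₂ : ℝ → Fin 3 → ℝ) (k : ℝ) {n : ℕ}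
    {F F' G G' : Series} (h : AgreeBelow n F F') (h' : AgreeBelow n G G') :
    AgreeBelow (n + 1)
      (invMixed (axialSource (scaleDefect r n₁ n₂) (scaleInv r n₁ n₂) k F G))
      (invMixed (axialSource (scaleDefect r n₁ n₂) (scaleInv r n₁ n₂) k F' G')) :=
  (AgreeBelow.axialSource (fun _ _ _ h => h.scaleDefect_mul r n₁ n₂) h h').invMixed

theorem agreeBelow_invEuler_angularSource (r n₁ n₂ : ℝ → Fin 3 → ℝ) (k : ℝ) {n : ℕ}
    {F F' G G' : Series} (h : AgreeBelow (n + 1) F F') (h' : AgreeBelow n G G') :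
    AgreeBelow (n + 1)
      (invEuler (angularSource (scaleDefect r n₁ n₂) (scaleInv r n₁ n₂) k F G))
      (invEuler (angularSource (scaleDefect r n₁ n₂) (scaleInv r n₁ n₂) k F' G')) :=
  (AgreeBelow.angularSource (fun _ _ _ h => h.scaleDefect_mul r n₁ n₂) h h').invEuler

theorem agreeBelow_axialStep (r n₁ n₂ : ℝ → Fin 3 → ℝ) (k : ℝ) (γ : ℝ → ℝ) (A : ℕ → ℝ → ℂ)
    (n : ℕ) (F F' G G' : Series) (h : AgreeBelow n F F') (h' : AgreeBelow n G G') :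
    AgreeBelow (n + 1) (axialStep r n₁ n₂ k γ A F G) (axialStep r n₁ n₂ k γ A F' G') :=
  (AgreeBelow.refl _ _).add (agreeBelow_invMixed_axialSource r n₁ n₂ k h h')

theorem agreeBelow_angularStep (r n₁ n₂ : ℝ → Fin 3 → ℝ) (k : ℝ) (B₀ : ℝ → ℝ)
    (n : ℕ) (F F' G G' : Series) (h : AgreeBelow (n + 1) F F') (h' : AgreeBelow n G G') :
    AgreeBelow (n + 1) (angularStep r n₁ n₂ k B₀ F G) (angularStep r n₁ n₂ k B₀ F' G') :=
  (AgreeBelow.refl _ _).add (agreeBelow_invEuler_angularSource r n₁ n₂ k h h')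

theorem isSmooth_below_of_fixedPoint (hr : IsClosedArcLengthCurve T r)
    (hn : IsBishopFrame r n₁ n₂) (hγ : ContDiff ℝ ∞ γ) (hA : ∀ n, ContDiff ℝ ∞ (A n))
    (hB : ContDiff ℝ ∞ B₀) (hs : αs = axialStep r n₁ n₂ k γ A αs αu)
    (hu : αu = angularStep r n₁ n₂ k B₀ αs αu) (n : ℕ) :
    IsSmooth (below n αs) ∧ IsSmooth (below n αu) :=
  below_induction n (agreeBelow_axialStep r n₁ n₂ k γ A) (agreeBelow_angularStep r n₁ n₂ k B₀)
    hs hu isSmooth_zero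
    (fun _ _ _ _ hF hG => ((isSmooth_harmonicSer hγ hA).add (IsSmooth.axialSource
      (isSmooth_scaleDefect hr hn) (isSmooth_scaleInv hr hn) hF hG).invMixed).below _)
    (fun _ _ _ _ hF hG => ((isSmooth_fn (Complex.ofRealCLM.contDiff.comp hB)).add
      (IsSmooth.angularSource (isSmooth_scaleDefect hr hn) (isSmooth_scaleInv hr hn)
        hF hG).invEuler).below _) n le_rfl

theorem conj_ofReal_fn (f : ℝ → ℝ) : conj (fn fun s => (f s : ℂ)) = fn fun s => (f s : ℂ) := by
  rw [conj_fn]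
  congr 1
  funext s
  simp

theorem conj_below_of_fixedPoint (hs : αs = axialStep r n₁ n₂ k γ A αs αu)
    (hu : αu = angularStep r n₁ n₂ k B₀ αs αu) (n : ℕ) :
    conj (below n αs) = below n αs ∧ conj (below n αu) = below n αu :=
  below_induction (P := fun F => conj F = F) n (agreeBelow_axialStep r n₁ n₂ k γ A)
    (agreeBelow_angularStep r n₁ n₂ k B₀) hs hu (map_zero _)
    (fun _ _ _ _ hF hG => by
      rw [conj_below, axialStep, map_add, conj_harmonicSer, conj_invMixed,
        conj_axialSource (conj_scaleDefect _ _ _) (conj_scaleInv _ _ _), hF, hG])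
    (fun _ _ _ _ hF hG => by
      rw [conj_below, angularStep, map_add, conj_ofReal_fn, conj_invEuler,
        conj_angularSource (conj_scaleDefect _ _ _) (conj_scaleInv _ _ _), hF, hG])
    n le_rfl

theorem isTwisted_below_of_fixedPoint (hr : IsClosedArcLengthCurve T r)
    (hn : IsBishopFrame r n₁ n₂) (hγ₀ : IsFrameAngle T n₁ n₂ γ₀)
    (hγT : ∀ s, γ (T + s) - γ s = γ₀) (hB : Function.Periodic B₀ T)
    (hs : αs = axialStep r n₁ n₂ k γ A αs αu)
    (hu : αu = angularStep r n₁ n₂ k B₀ αs αu) {n : ℕ}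
    (hA : ∀ j < n, Function.Periodic (A j) T) :
    IsTwisted (Complex.exp (-(Complex.I * γ₀))) T 0 (below n αs) ∧
      IsTwisted (Complex.exp (-(Complex.I * γ₀))) T 0 (below n αu) := by
  have hζ := Complex.exp_ne_zero (-(Complex.I * γ₀))
  have hw := isTwisted_scaleDefect hr hn hγ₀
  have hq := isTwisted_scaleInv hr hn hγ₀
  refine below_induction n (agreeBelow_axialStep r n₁ n₂ k γ A)
    (agreeBelow_angularStep r n₁ n₂ k B₀) hs hu isTwisted_zero ?_ ?_ n le_rfl
  · intro m hm F G hF hG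
    rw [axialStep, below_add]
    exact (isTwisted_below_harmonicSer hγT fun j hj => hA j (by omega)).add
      ((IsTwisted.axialSource hζ hw hq hF hG).invMixed.below _)
  · intro m _ F G hF hG
    refine ((isTwisted_fn fun s => ?_).add
      (IsTwisted.angularSource hζ hw hq hF hG).invEuler).below _
    rw [hB s, zpow_zero, one_mul]

theorem isBeltramiPotential_of_fixedPoint (hr : IsClosedArcLengthCurve T r)
    (hn : IsBishopFrame r n₁ n₂) (hαs : IsSmooth αs) (hαu : IsSmooth αu)
    (hs : αs = axialStep r n₁ n₂ k γ A αs αu)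
    (hu : αu = angularStep r n₁ n₂ k B₀ αs αu) :
    IsBeltramiPotential r n₁ n₂ k (gaugeForm αs αu) := by
  intro i
  rw [starD_eq_field hr hn, starD_eq_field hr hn]
  refine congrFun (field_field_eq (scale_mul_scaleInv r n₁ n₂) (isSmooth_scaleDefect hr hn)
    (isSmooth_scaleInv hr hn) hαs hαu ?_ (euler_eq_of_fixedPoint cf_zero_zero_angularSource hu)) i
  conv_lhs => rw [hs, axialStep]
  rw [map_add, map_add, pderiv_pderiv_harmonicSer, pderiv_pderiv_invMixed, zero_add]

end Solution

end NearAxis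
end

open NearAxis
theorem mainTheorem1 (T k γ₀ : ℝ) (r n₁ n₂ : ℝ → Fin 3 → ℝ) (γ : ℝ → ℝ)
    (hr : IsClosedArcLengthCurve T r) (hn : IsBishopFrame r n₁ n₂)
    (hγ₀ : IsFrameAngle T n₁ n₂ γ₀) (hγ : ContDiff ℝ ∞ γ)
    (hγT : ∀ s, γ (T + s) - γ s = γ₀) :
    -- `𝓡 n` and `𝓩 n` compute `R_n` and `α_z^n` from the lower orders
    (∃ 𝓡 𝓩 : ℕ → Series → Series → Coeffs,
      ∀ (A : ℕ → ℝ → ℂ) (B₀ : ℝ → ℝ), (∀ n, ContDiff ℝ ∞ (A n)) → ContDiff ℝ ∞ B₀ →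
        ∃ (αs αu : Series) (R αz : ℕ → Coeffs),
          (IsSmooth αs ∧ IsReal αs ∧ IsSmooth αu ∧ IsReal αu) ∧
          IsBeltramiPotential r n₁ n₂ k (gaugeForm αs αu) ∧
          (∀ n, homPart n αs =
            fn (A n) * zSer γ ^ n + fn (fun s => star (A n s)) * zbarSer γ ^ n
              + zPoly γ n (R n)) ∧
          (∀ n, homPart n αu = zPoly γ n (αz n)) ∧
          homPart 0 αu = fn (fun s => (B₀ s : ℂ)) ∧
          (∀ n, R n = 𝓡 n (below n αs) (below n αu)) ∧
          (∀ n, 1 ≤ n → αz n = 𝓩 n (below (n + 1) αs) (below n αu)) ∧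
          (∀ n, IsRealCoeffs (R n) ∧ IsRealCoeffs (αz n)) ∧
          (Function.Periodic B₀ T →
            (∀ n, (∀ j < n, Function.Periodic (A j) T) → IsPeriodicCoeffs T (R n)) ∧
            (∀ n, (∀ j ≤ n, Function.Periodic (A j) T) → IsPeriodicCoeffs T (αz n)) ∧
            ((∀ n, Function.Periodic (A n) T) →
              IsPeriodicInZ γ T αs ∧ IsPeriodicInZ γ T αu)) ∧
          (A 0 = 0 → A 1 = 0 →
            homPart 0 αs = 0 ∧ homPart 1 αs = 0 ∧
              OnAxisField r n₁ n₂ (gaugeForm αs αu) B₀)) ∧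
    (∀ (αs αu : Series) (B₀ : ℝ → ℝ),
      (IsSmooth αs ∧ IsReal αs ∧ IsSmooth αu ∧ IsReal αu) →
      IsBeltramiPotential r n₁ n₂ k (gaugeForm αs αu) →
      OnAxisField r n₁ n₂ (gaugeForm αs αu) B₀ →
        homPart 0 αu = fn (fun s => (B₀ s : ℂ)) ∧
        starD r n₁ n₂ (gaugeForm (αs - homPart 0 αs - homPart 1 αs) αu)
          = starD r n₁ n₂ (gaugeForm αs αu)) := by

  constructor
  · refine ⟨fun _ F G => toCoeffs γ
        (invMixed (axialSource (scaleDefect r n₁ n₂) (scaleInv r n₁ n₂) k F G)),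
      fun _ F G => toCoeffs γ
        (invEuler (angularSource (scaleDefect r n₁ n₂) (scaleInv r n₁ n₂) k F G)), ?_⟩
    intro A B₀ hA hB
    obtain ⟨αs, αu, hs, hu⟩ := exists_fixedPoint (agreeBelow_axialStep r n₁ n₂ k γ A)
      (agreeBelow_angularStep r n₁ n₂ k B₀)
    have hsm := isSmooth_below_of_fixedPoint hr hn hγ hA hB hs hu
    have hre := conj_below_of_fixedPoint hs hu
    have hαs : IsSmooth αs := isSmooth_of_below fun n => (hsm n).1
    have hαu : IsSmooth αu := isSmooth_of_below fun n => (hsm n).2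
    have hB' : ContDiff ℝ ∞ fun s => (B₀ s : ℂ) := Complex.ofRealCLM.contDiff.comp hB
    have hw := isSmooth_scaleDefect hr hn
    have hq := isSmooth_scaleInv hr hn
    have hwr := conj_scaleDefect r n₁ n₂
    have hqr := conj_scaleInv r n₁ n₂
    have hζ := Complex.exp_ne_zero (-(Complex.I * γ₀))
    have hu0 : homPart 0 αu = fn (fun s => (B₀ s : ℂ)) := by
      rw [homPart_zero_eq_fn, hu, angularStep, map_add, cf_fn, invEuler, cf_ofCoeffs]
      congr 1
      funext s
      simp
    refine ⟨αs, αu, fun n => toCoeffs γ (invMixed (axialSource (scaleDefect r n₁ n₂)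
        (scaleInv r n₁ n₂) k (below n αs) (below n αu))),
      -- order zero of `α_u` is the prescribed `B₀`; only the higher orders are computed
      fun n => if n = 0 then toCoeffs γ (fn fun s => (B₀ s : ℂ)) else
        toCoeffs γ (invEuler (angularSource (scaleDefect r n₁ n₂) (scaleInv r n₁ n₂) k
          (below (n + 1) αs) (below n αu))),
      ⟨hαs, isReal_iff.2 (conj_eq_of_below fun n => (hre n).1), hαu,
        isReal_iff.2 (conj_eq_of_below fun n => (hre n).2)⟩,
      isBeltramiPotential_of_fixedPoint hr hn hαs hαu hs hu, ?_, ?_, hu0, fun _ => rfl,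
      fun n hn => if_neg (by omega), ?_, ?_, ?_⟩
    · intro n
      conv_lhs => rw [hs]
      rw [axialStep, homPart_add, homPart_harmonicSer, zPoly_toCoeffs,
        (agreeBelow_invMixed_axialSource r n₁ n₂ k (agreeBelow_below n αs)
          (agreeBelow_below n αu)).homPart_eq]
    · intro n
      beta_reduce
      rcases n with _ | n
      · rw [if_pos rfl, zPoly_toCoeffs, hu0, homPart_zero_eq_fn, cf_fn, if_pos ⟨rfl, rfl⟩]
      · have hc : homPart (n + 1) (fn fun s => (B₀ s : ℂ)) = 0 := by
          refine ext_cf fun i j => ?_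
          rw [cf_homPart, cf_fn, map_zero]
          split_ifs
          · omega
          · rfl
          · rfl
        conv_lhs => rw [hu]
        rw [if_neg (Nat.succ_ne_zero n), zPoly_toCoeffs, angularStep, homPart_add, hc, zero_add,
          (agreeBelow_invEuler_angularSource r n₁ n₂ k (agreeBelow_below (n + 1 + 1) αs)
            (agreeBelow_below (n + 1) αu)).homPart_eq]
    · intro n
      constructor
      · refine isRealCoeffs_toCoeffs hγ (hw.axialSource hq (hsm n).1 (hsm n).2).invMixed ?_
        rw [conj_invMixed, conj_axialSource hwr hqr, (hre n).1, (hre n).2]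
      · dsimp only
        split_ifs
        · exact isRealCoeffs_toCoeffs hγ (isSmooth_fn hB') (conj_ofReal_fn B₀)
        · refine isRealCoeffs_toCoeffs hγ
            (hw.angularSource hq (hsm (n + 1)).1 (hsm n).2).invEuler ?_
          rw [conj_invEuler, conj_angularSource hwr hqr, (hre (n + 1)).1, (hre n).2]
    · intro hBT
      have htw := @isTwisted_below_of_fixedPoint T k γ₀ r n₁ n₂ γ A B₀ αs αu hr hn hγ₀ hγT hBT hs hu
      have hwt := isTwisted_scaleDefect hr hn hγ₀
      have hqt := isTwisted_scaleInv hr hn hγ₀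
      refine ⟨fun n hAn => ?_, fun n hAn => ?_, fun hAT => ⟨⟨toCoeffs γ αs, ?_, ?_⟩,
        ⟨toCoeffs γ αu, ?_, ?_⟩⟩⟩
      · exact isPeriodicCoeffs_toCoeffs hγT
          (IsTwisted.axialSource hζ hwt hqt (htw hAn).1 (htw hAn).2).invMixed
      · dsimp only
        split_ifs
        · refine isPeriodicCoeffs_toCoeffs hγT (isTwisted_fn fun s => ?_)
          rw [hBT s, zpow_zero, one_mul]
        · exact isPeriodicCoeffs_toCoeffs hγT
            (IsTwisted.angularSource hζ hwt hqt (htw fun j hj => hAn j (by omega)).1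
              (htw fun j hj => hAn j (by omega)).2).invEuler
      · exact isPeriodicCoeffs_toCoeffs hγT (isTwisted_of_below fun n => (htw fun j _ => hAT j).1)
      · exact fun n => (zPoly_toCoeffs γ n αs).symm
      · exact isPeriodicCoeffs_toCoeffs hγT (isTwisted_of_below fun n => (htw fun j _ => hAT j).2)
      · exact fun n => (zPoly_toCoeffs γ n αu).symm
    · intro hA0 hA1
      have hcf : cf 0 0 αs = 0 ∧ cf 1 0 αs = 0 ∧ cf 0 1 αs = 0 := by
        rw [hs, axialStep]
        refine ⟨?_, ?_, ?_⟩ <;>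
        · rw [map_add, harmonicSer, invMixed, cf_ofCoeffs, cf_ofCoeffs]
          funext s
          simp [hA0, hA1]
      refine ⟨?_, homPart_one_eq_zero hcf.2.1 hcf.2.2, ?_⟩
      · rw [homPart_zero_eq_fn, hcf.1, fn_zero]
      · refine (onAxisField_iff hr hn αs αu B₀).2 ⟨hcf.2.1, hcf.2.2, ?_⟩
        have h := congrArg (cf 0 0) hu0
        rwa [cf_homPart, cf_fn, if_pos rfl, if_pos ⟨rfl, rfl⟩] at h
  · -- only the values of `⋆dα` on the axis are used, not the Beltrami equation
    intro αs αu B₀ _ _ hax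
    obtain ⟨h₁, h₂, h₃⟩ := (onAxisField_iff hr hn αs αu B₀).1 hax
    refine ⟨?_, ?_⟩
    · rw [homPart_zero_eq_fn, h₃]
    · rw [homPart_one_eq_zero h₁ h₂, sub_zero, homPart_zero_eq_fn, starD_gaugeForm_sub_fn]
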